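/- Let $p\ge q\ge 2$ be integers. For a real $p\times q$ matrix $A$ with singular values $\sigma_1(A)\ge\dots\ge\sigma_q(A)\ge 0$ put $\|A\|_2^2=\sum_{i=1}^q\sigma_i(A)^2$, $\|A\|_\infty=\sigma_1(A)$, and, if $A\neq 0$, define the effective rank $\mathrm{ER}_{2,\infty}(A)=\|A\|_2^2/\|A\|_\infty^2$. One observes $Y=A+E$, where $E$ is a $p\times q$ matrix with independent standard normal entries; write $\mathbb P_A$ for the law of $Y$. Consider the estimator $$\widehat{\mathrm{ER}}_{2,\infty}=\max\left[\frac{\operatorname{tr}(Y^TY-pI_q)}{\|Y^TY-pI_q\|_\infty},\,1\right].$$ (Upper bound.) For every $\alpha\in(0,1/2)$ there are constants $c_\alpha,c'_\alpha>0$, depending only on $\alpha$, such that for all integers $p\ge q\ge2$ and all real $p\times q$ matrices $A$ with $\sigma_1(A)\ge c_\alpha(pq)^{1/4}$, $$\mathbb P_A\left[\frac{|\widehat{\mathrm{ER}}_{2,\infty}-\mathrm{ER}_{2,\infty}(A)|}{\mathrm{ER}_{2,\infty}(A)}\le c'_\alpha\left(\frac{\sqrt{pq}}{\sigma_1(A)^2}+\frac{\sqrt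 q}{\sigma_1(A)}\right)\right]\ge 1-\alpha .$$ (Lower bound.) There is a numerical constant $c>0$ such that for all integers $p\ge q\ge2$ and all real $r\ge(pq)^{1/4}$, $$\inf_{\widehat R}\ \sup_{A\in\mathbb R^{p\times q}:\ \sigma_1(A)\ge r}\ \mathbb P_A\left[\frac{|\widehat R(Y)-\mathrm{ER}_{2,\infty}(A)|}{\mathrm{ER}_{2,\infty}(A)}\ge c\left(\frac{\sqrt{pq}}{r^2}+\frac{\sqrt q}{r}\right)\right]\ge 0.2,$$ where the infimum is over all estimators, i.e. all measurable functions $\widehat R:\mathbb R^{p\times q}\to\mathbb R$. -/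

import Mathlib

open MeasureTheory ProbabilityTheory
open scoped ENNReal Matrix

noncomputable section

namespace EffRank

/-- The `i`-th singular value of a real matrix (zero-indexed, in decreasing order, with
multiplicity): `sv A 0` is `σ₁(A)`. -/
def sv {m n : ℕ} (A : Matrix (Fin m) (Fin n) ℝ) (i : ℕ) : ℝ :=
  (Matrix.toEuclideanLin A).singularValues i

/-- The Schatten norm `‖A‖ₛ = (∑ᵢ σᵢ(A)^s)^(1/s)`, for real `s ≥ 1`; the sum runs over the
`n` singular values of the `m × n` matrix. -/
def schattenNorm {m n : ℕ} (s : ℝ) (A : Matrix (Fin m) (Fin n) ℝ) : ℝ :=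
  (∑ i : Fin n, sv A i ^ s) ^ (1 / s)

/-- The operator norm `‖A‖_∞ = σ₁(A)`. -/
def opNorm {m n : ℕ} (A : Matrix (Fin m) (Fin n) ℝ) : ℝ :=
  sv A 0

/-- The effective rank `‖A‖₂² / ‖A‖_∞²`. -/
def effRank {m n : ℕ} (A : Matrix (Fin m) (Fin n) ℝ) : ℝ :=
  schattenNorm 2 A ^ 2 / opNorm A ^ 2

/-- The plug-in estimator `max (tr(YᵀY - p I_q) / ‖YᵀY - p I_q‖_∞, 1)`. -/
def effRankEst {p q : ℕ} (Y : Matrix (Fin p) (Fin q) ℝ) : ℝ :=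
  max ((Yᵀ * Y - (p : ℝ) • (1 : Matrix (Fin q) (Fin q) ℝ)).trace /
    opNorm (Yᵀ * Y - (p : ℝ) • (1 : Matrix (Fin q) (Fin q) ℝ))) 1

/-- The product (Borel) σ-algebra on real matrices. -/
instance instMeasurableSpaceMatrix (p q : ℕ) : MeasurableSpace (Matrix (Fin p) (Fin q) ℝ) :=
  inferInstanceAs (MeasurableSpace (Fin p → Fin q → ℝ))

/-- The law of a `p × q` matrix `E` with independent standard normal entries. -/
def noiseLaw (p q : ℕ) : Measure (Matrix (Fin p) (Fin q) ℝ) :=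
  Measure.pi fun _ : Fin p => Measure.pi fun _ : Fin q => gaussianReal 0 1

/-- The law of the observation `Y = A + E`. -/
def obsLaw {p q : ℕ} (A : Matrix (Fin p) (Fin q) ℝ) : Measure (Matrix (Fin p) (Fin q) ℝ) :=
  (noiseLaw p q).map fun E => A + E

end EffRank

end

/-! Upper bound. Put W = `gramError A E` = YᵀY - pI - AᵀA. For a unit vector v the form vᵀWv is a
sum of independent terms g² - 1 + 2(Av)ᵢg with g standard normal, hence sub-exponential with
variance proxy p + ‖Av‖² (`integral_exp_chiSquare_le`). A union bound over a 1/2-net with at most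
5^q points gives σ₁(W) ≲ √(q(p + σ₁(A)²)), and the same exponential moment summed over all entries
gives |tr W| ≲ √(pq + ‖A‖₂²). Since σ₁(AᵀA) = σ₁(A)² and tr AᵀA = ‖A‖₂², what remains is a
deterministic perturbation of a quotient (`relative_error_le`).

Lower bound. Each of the two terms of the rate comes from its own Le Cam argument, testing one
matrix against a uniform mixture indexed by signs, along which the effective rank is constant
(`one_fifth_le_minimax_risk`). The second moment of the mixture likelihood ratio is the mean of
exp⟨D, D'⟩ over independent pairs of shifts. For √(pq)/r², a rank-one matrix of norm r is completed
by a block of random signs with squared Frobenius norm √(pq)/3: σ₁ is unchanged, while the effective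
rank rises from 1 to 1 + √(pq)/(3r²). For √q/r, the matrix rI receives a spike of size √q/3 in a
random sign direction: ‖A‖₂² changes little in relative terms, but σ₁ grows, so the effective rank
falls from q by a factor about 1 - c√q/r. -/

namespace LinearMap

/-! ### Singular values of linear maps -/

variable {E F : Type*} [NormedAddCommGroup E] [InnerProductSpace ℝ E] [FiniteDimensional ℝ E]
  [NormedAddCommGroup F] [InnerProductSpace ℝ F] [FiniteDimensional ℝ F]

theorem norm_apply_le_singularValues_zero_mul (T : E →ₗ[ℝ] F) (x : E) :
    ‖T x‖ ≤ T.singularValues 0 * ‖x‖ := by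
  have h0 : 0 ≤ T.singularValues 0 := T.singularValues_nonneg 0
  refine le_of_sq_le_sq ?_ (by positivity)
  set S := adjoint T ∘ₗ T with hS
  have hsym : S.IsSymmetric := T.isSymmetric_adjoint_comp_self
  let b := hsym.eigenvectorBasis rfl
  have h1 : ‖T x‖ ^ 2 = inner ℝ x (S x) := by
    rw [hS, comp_apply, adjoint_inner_right, real_inner_self_eq_norm_sq]
  rw [h1, ← b.sum_inner_mul_inner, mul_pow, ← real_inner_self_eq_norm_sq x,
    ← b.sum_inner_mul_inner, Finset.mul_sum]
  refine Finset.sum_le_sum fun i _ => ?_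
  have h2 : inner ℝ (b i) (S x) = hsym.eigenvalues rfl i * inner ℝ (b i) x := by
    rw [← hsym (b i) x, hsym.apply_eigenvectorBasis rfl i, inner_smul_left]; simp [b]
  have h3 : hsym.eigenvalues rfl i ≤ T.singularValues 0 ^ 2 := by
    rw [← T.sq_singularValues_fin rfl i]
    exact pow_le_pow_left₀ (T.singularValues_nonneg _) (T.singularValues_antitone (Nat.zero_le _)) 2
  rw [h2, real_inner_comm x (b i)]
  nlinarith [mul_le_mul_of_nonneg_right h3 (mul_self_nonneg (inner ℝ (b i) x))]

theorem exists_norm_eq_one_norm_apply_eq_singularValues_zero (T : E →ₗ[ℝ] F)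
    (hE : 0 < Module.finrank ℝ E) : ∃ x, ‖x‖ = 1 ∧ ‖T x‖ = T.singularValues 0 := by
  have hsym : (adjoint T ∘ₗ T).IsSymmetric := T.isSymmetric_adjoint_comp_self
  let b := hsym.eigenvectorBasis rfl
  refine ⟨b ⟨0, hE⟩, b.orthonormal.1 _, ?_⟩
  refine (sq_eq_sq₀ (norm_nonneg _) (T.singularValues_nonneg 0)).1 ?_
  have h1 : ‖T (b ⟨0, hE⟩)‖ ^ 2 = inner ℝ (b ⟨0, hE⟩) ((adjoint T ∘ₗ T) (b ⟨0, hE⟩)) := by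
    rw [comp_apply, adjoint_inner_right, real_inner_self_eq_norm_sq]
  rw [h1, hsym.apply_eigenvectorBasis rfl, inner_smul_right,
    real_inner_self_eq_norm_sq, b.orthonormal.1]
  simp [T.sq_singularValues_of_lt rfl hE]

/-- Both sides are the trace of `adjoint T ∘ₗ T`, once in an eigenbasis and once in `b`. -/
theorem sum_sq_singularValues (T : E →ₗ[ℝ] F) {ι : Type*} [Fintype ι]
    (b : OrthonormalBasis ι ℝ E) {n : ℕ} (hn : Module.finrank ℝ E = n) :
    ∑ i : Fin n, T.singularValues i ^ 2 = ∑ j, ‖T (b j)‖ ^ 2 := by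
  have h := T.isSymmetric_adjoint_comp_self.trace_eq_sum_eigenvalues hn
  rw [trace_eq_sum_inner _ b] at h
  simp only [T.sq_singularValues_fin hn]
  simp only [RCLike.ofReal_real_eq_id, id_eq] at h
  rw [← h]
  refine Finset.sum_congr rfl fun j _ => ?_
  rw [comp_apply, adjoint_inner_right, real_inner_self_eq_norm_sq]

end LinearMap

namespace EffRank

/-! ### Singular values of matrices; reduction of norms to nets -/

variable {m n : ℕ}

theorem sum_sq_mulVec_le (A : Matrix (Fin m) (Fin n) ℝ) (x : Fin n → ℝ) :
    ∑ i, (A *ᵥ x) i ^ 2 ≤ sv A 0 ^ 2 * ∑ j, x j ^ 2 := by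
  have h := (Matrix.toEuclideanLin A).norm_apply_le_singularValues_zero_mul (WithLp.toLp 2 x)
  have h2 := pow_le_pow_left₀ (norm_nonneg _) h 2
  rw [mul_pow, EuclideanSpace.real_norm_sq_eq, EuclideanSpace.real_norm_sq_eq] at h2
  exact h2

theorem exists_sum_sq_mulVec_eq (A : Matrix (Fin m) (Fin n) ℝ) (hn : 0 < n) :
    ∃ x : Fin n → ℝ, ∑ j, x j ^ 2 = 1 ∧ ∑ i, (A *ᵥ x) i ^ 2 = sv A 0 ^ 2 := by
  obtain ⟨x, hx, hAx⟩ :=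
    (Matrix.toEuclideanLin A).exists_norm_eq_one_norm_apply_eq_singularValues_zero (by simpa using hn)
  refine ⟨x, ?_, ?_⟩
  · rw [← EuclideanSpace.real_norm_sq_eq, hx, one_pow]
  · rw [sv, ← hAx, EuclideanSpace.real_norm_sq_eq]; rfl

theorem sv_nonneg (A : Matrix (Fin m) (Fin n) ℝ) (i : ℕ) : 0 ≤ sv A i :=
  LinearMap.singularValues_nonneg _ _

/-- A variational characterization of the largest singular value. -/
theorem sv_zero_eq (A : Matrix (Fin m) (Fin n) ℝ) {N : ℝ} (hN : 0 ≤ N)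
    (hle : ∀ x : Fin n → ℝ, ∑ i, (A *ᵥ x) i ^ 2 ≤ N ^ 2 * ∑ j, x j ^ 2)
    (x : Fin n → ℝ) (hx : ∑ j, x j ^ 2 = 1) (hAx : ∑ i, (A *ᵥ x) i ^ 2 = N ^ 2) :
    sv A 0 = N := by
  have hn : 0 < n := by
    rcases Nat.eq_zero_or_pos n with rfl | h
    · simp at hx
    · exact h
  obtain ⟨y, hy, hAy⟩ := exists_sum_sq_mulVec_eq A hn
  refine (sq_eq_sq₀ (sv_nonneg A 0) hN).1 (le_antisymm ?_ ?_)
  · simpa [hAy, hy] using hle y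
  · simpa [hAx, hx] using sum_sq_mulVec_le A x

theorem sum_sv_sq (A : Matrix (Fin m) (Fin n) ℝ) :
    ∑ i : Fin n, sv A i ^ 2 = ∑ i, ∑ j, A i j ^ 2 := by
  have h := (Matrix.toEuclideanLin A).sum_sq_singularValues (EuclideanSpace.basisFun (Fin n) ℝ)
    (n := n) (by simp)
  simp only [sv]
  rw [h, Finset.sum_comm]
  refine Finset.sum_congr rfl fun j _ => ?_
  rw [EuclideanSpace.real_norm_sq_eq]
  simp

theorem effRank_eq (A : Matrix (Fin m) (Fin n) ℝ) :
    effRank A = (∑ i, ∑ j, A i j ^ 2) / sv A 0 ^ 2 := by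
  have h : ∑ i : Fin n, sv A i ^ (2 : ℝ) = ∑ i, ∑ j, A i j ^ 2 := by
    rw [← sum_sv_sq]; simp
  have h0 : 0 ≤ ∑ i, ∑ j, A i j ^ 2 := by positivity
  rw [effRank, opNorm, schattenNorm, h, ← Real.sqrt_eq_rpow, Real.sq_sqrt h0]

theorem sv_zero_sq_le (A : Matrix (Fin m) (Fin n) ℝ) (hn : 0 < n) :
    sv A 0 ^ 2 ≤ ∑ i, ∑ j, A i j ^ 2 := by
  rw [← sum_sv_sq]
  exact Finset.single_le_sum (f := fun i : Fin n => sv A i ^ 2) (fun _ _ => sq_nonneg _)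
    (Finset.mem_univ ⟨0, hn⟩)

section L2

open scoped Matrix.Norms.L2Operator

theorem sv_zero_eq_norm (A : Matrix (Fin m) (Fin n) ℝ) (hn : 0 < n) : sv A 0 = ‖A‖ := by
  rw [Matrix.l2_opNorm_def]
  apply le_antisymm
  · obtain ⟨x, hx, hAx⟩ :=
      (Matrix.toEuclideanLin A).exists_norm_eq_one_norm_apply_eq_singularValues_zero
        (by simpa using hn)
    rw [sv, ← hAx]
    refine ((LinearMap.toContinuousLinearMap (Matrix.toEuclideanLin A)).le_opNorm x).trans ?_
    rw [hx, mul_one]; rfl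
  · exact ContinuousLinearMap.opNorm_le_bound _ (sv_nonneg A 0) fun x =>
      (Matrix.toEuclideanLin A).norm_apply_le_singularValues_zero_mul x

theorem sv_zero_transpose_mul_self (A : Matrix (Fin m) (Fin n) ℝ) (hn : 0 < n) :
    sv (Aᵀ * A) 0 = sv A 0 ^ 2 := by
  rw [sv_zero_eq_norm _ hn, sv_zero_eq_norm _ hn, sq, ← Matrix.l2_opNorm_conjTranspose_mul_self,
    Matrix.conjTranspose_eq_transpose_of_trivial]

theorem abs_sv_zero_sub_le (A B : Matrix (Fin m) (Fin n) ℝ) (hn : 0 < n) :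
    |sv A 0 - sv B 0| ≤ sv (A - B) 0 := by
  simp only [sv_zero_eq_norm _ hn]
  exact abs_norm_sub_norm_le A B

end L2

/-- With σ = `sv M 0`, symmetry makes σ² an eigenvalue of T², so (T - σ)(T + σ)x = 0 for some x ≠ 0.
Either (T + σ)x = 0, or it is an eigenvector for σ. -/
theorem exists_eigenvector_abs_eq_sv_zero {M : Matrix (Fin n) (Fin n) ℝ} (hM : M.IsSymm)
    (hn : 0 < n) :
    ∃ (c : ℝ) (v : EuclideanSpace ℝ (Fin n)), |c| = sv M 0 ∧ ‖v‖ = 1 ∧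
      Matrix.toEuclideanLin M v = c • v := by
  set T := Matrix.toEuclideanLin M with hT
  suffices h : ∃ (c : ℝ) (v : EuclideanSpace ℝ (Fin n)), |c| = sv M 0 ∧ v ≠ 0 ∧ T v = c • v by
    obtain ⟨c, v, hc, hv, hTv⟩ := h
    refine ⟨c, ‖v‖⁻¹ • v, hc, norm_smul_inv_norm hv, ?_⟩
    rw [map_smul, hTv, smul_comm]
  have hadj : LinearMap.adjoint T = T := by
    rw [hT, ← Matrix.toEuclideanLin_conjTranspose_eq_adjoint,
      Matrix.conjTranspose_eq_transpose_of_trivial, hM.eq]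
  have h0 : 0 ≤ sv M 0 := sv_nonneg M 0
  have hev := T.hasEigenvalue_adjoint_comp_self_sq_singularValues (n := 0) (by simpa using hn)
  obtain ⟨x, hx⟩ := hev.exists_hasEigenvector
  have hTT : T (T x) = sv M 0 ^ 2 • x := by
    have := hx.apply_eq_smul
    rwa [hadj] at this
  by_cases hu : T x + sv M 0 • x = 0
  · refine ⟨-sv M 0, x, by rw [abs_neg, abs_of_nonneg h0], hx.2, ?_⟩
    rw [neg_smul]; exact eq_neg_of_add_eq_zero_left hu
  · refine ⟨sv M 0, T x + sv M 0 • x, abs_of_nonneg h0, hu, ?_⟩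
    rw [map_add, map_smul, hTT, smul_add, smul_smul, sq, add_comm]

/-- A symmetric matrix is controlled by its quadratic form on a `1/2`-net of the sphere. -/
theorem sv_zero_le_of_net {M : Matrix (Fin n) (Fin n) ℝ} (hM : M.IsSymm) (hn : 0 < n)
    {s : Finset (EuclideanSpace ℝ (Fin n))} (hs : ∀ v ∈ s, ‖v‖ = 1)
    (hnet : ∀ v : EuclideanSpace ℝ (Fin n), ‖v‖ = 1 → ∃ w ∈ s, ‖v - w‖ ≤ 1 / 2)
    {t : ℝ} (ht : ∀ v ∈ s, |v.ofLp ⬝ᵥ (M *ᵥ v.ofLp)| ≤ t) : sv M 0 ≤ 2 * t := by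
  obtain ⟨c, v, hc, hv, hMv⟩ := exists_eigenvector_abs_eq_sv_zero hM hn
  obtain ⟨w, hw, hvw⟩ := hnet v hv
  set T := Matrix.toEuclideanLin M with hT
  have hq : w.ofLp ⬝ᵥ (M *ᵥ w.ofLp) = inner ℝ w (T w) := by
    rw [EuclideanSpace.inner_eq_star_dotProduct, dotProduct_comm]; simp [hT]
  have hsym : ∀ x y, inner ℝ (T x) y = inner ℝ x (T y) := by
    intro x y
    rw [← LinearMap.adjoint_inner_right, hT, ← Matrix.toEuclideanLin_conjTranspose_eq_adjoint,
      Matrix.conjTranspose_eq_transpose_of_trivial, hM.eq]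
  set d := v - w with hd
  have hwd : w = v - d := by simp [hd]
  -- Because `v` is an eigenvector, the error in passing from `v` to `w` is quadratic in `d`. With
  -- ‖d‖² ≤ 1/4 at least half of |c| survives, whence the factor 2.
  have hexp : inner ℝ w (T w) = c * (1 - ‖d‖ ^ 2) + inner ℝ d (T d) := by
    have h1 : inner ℝ d v = ‖d‖ ^ 2 / 2 := by
      have := norm_sub_sq_real v d
      rw [← hwd, hs w hw, hv, real_inner_comm] at this
      linarith
    have h2 : inner ℝ v (T d) = c * inner ℝ d v := by
      rw [← hsym, hMv, inner_smul_left, real_inner_comm]; simp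
    rw [hwd, map_sub, inner_sub_left, inner_sub_right, inner_sub_right, h2, hMv,
      inner_smul_right, inner_smul_right, h1, real_inner_self_eq_norm_sq, hv]
    ring
  have hTd : |inner ℝ d (T d)| ≤ sv M 0 * ‖d‖ ^ 2 := by
    refine (abs_real_inner_le_norm _ _).trans ?_
    have := mul_le_mul_of_nonneg_left (T.norm_apply_le_singularValues_zero_mul d) (norm_nonneg d)
    refine this.trans (le_of_eq ?_)
    rw [sv]; ring
  have hd2 : ‖d‖ ^ 2 ≤ 1 / 4 := by nlinarith [norm_nonneg d]
  have h0 := sv_nonneg M 0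
  have h3 := ht w hw
  rw [hq, hexp] at h3
  have h4 : |c * (1 - ‖d‖ ^ 2)| = sv M 0 * (1 - ‖d‖ ^ 2) := by
    rw [abs_mul, hc, abs_of_nonneg (by linarith)]
  have h5 := abs_sub_abs_le_abs_sub (c * (1 - ‖d‖ ^ 2)) (-inner ℝ d (T d))
  rw [sub_neg_eq_add, abs_neg, h4] at h5
  nlinarith

/-- A 1/2-separated subset of the sphere of largest cardinality is a 1/2-net. After scaling by 2 it
is 1-separated in the ball of radius 2, so the Besicovitch volume bound gives 5^n. -/
theorem exists_net_card_le (n : ℕ) : ∃ s : Finset (EuclideanSpace ℝ (Fin n)),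
    s.card ≤ 5 ^ n ∧ (∀ v ∈ s, ‖v‖ = 1) ∧
      ∀ v : EuclideanSpace ℝ (Fin n), ‖v‖ = 1 → ∃ w ∈ s, ‖v - w‖ ≤ 1 / 2 := by
  classical
  let P : ℕ → Prop := fun k => ∃ s : Finset (EuclideanSpace ℝ (Fin n)), s.card = k ∧
    (∀ v ∈ s, ‖v‖ = 1) ∧ ∀ v ∈ s, ∀ w ∈ s, v ≠ w → 1 / 2 ≤ ‖v - w‖
  have hbound : ∀ s : Finset (EuclideanSpace ℝ (Fin n)), (∀ v ∈ s, ‖v‖ = 1) →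
      (∀ v ∈ s, ∀ w ∈ s, v ≠ w → 1 / 2 ≤ ‖v - w‖) → s.card ≤ 5 ^ n := by
    intro s h1 h2
    have hinj : Function.Injective fun v : EuclideanSpace ℝ (Fin n) => (2 : ℝ) • v :=
      smul_right_injective _ two_ne_zero
    rw [← Finset.card_image_of_injective s hinj]
    have := Besicovitch.card_le_of_separated (s.image fun v => (2 : ℝ) • v) ?_ ?_
    · simpa using this
    · intro c hc
      obtain ⟨v, hv, rfl⟩ := Finset.mem_image.1 hc
      simp [norm_smul, h1 v hv]
    · intro c hc d hd hcd
      obtain ⟨v, hv, rfl⟩ := Finset.mem_image.1 hc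
      obtain ⟨w, hw, rfl⟩ := Finset.mem_image.1 hd
      have := h2 v hv w hw (fun h => hcd (by rw [h]))
      rw [← smul_sub, norm_smul, Real.norm_eq_abs, abs_two]
      linarith
  have hP0 : P 0 := ⟨∅, by simp⟩
  obtain ⟨s, hcard, hs1, hs2⟩ := Nat.findGreatest_spec (P := P) (Nat.zero_le (5 ^ n)) hP0
  refine ⟨s, hbound s hs1 hs2, hs1, fun v hv => ?_⟩
  by_contra! hcon
  have hvs : v ∉ s := fun h => by
    have := hcon v h
    rw [sub_self, norm_zero] at this
    norm_num at this
  have h1 : ∀ w ∈ insert v s, ‖w‖ = 1 := by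
    intro w hw
    rcases Finset.mem_insert.1 hw with rfl | hw
    · exact hv
    · exact hs1 w hw
  have h2 : ∀ x ∈ insert v s, ∀ y ∈ insert v s, x ≠ y → 1 / 2 ≤ ‖x - y‖ := by
    intro x hx y hy hxy
    rcases Finset.mem_insert.1 hx with rfl | hxs <;>
      rcases Finset.mem_insert.1 hy with rfl | hys
    · exact absurd rfl hxy
    · exact (hcon y hys).le
    · rw [norm_sub_rev]; exact (hcon x hxs).le
    · exact hs2 x hxs y hys hxy
  have h3 := Nat.le_findGreatest (P := P) (hbound _ h1 h2) ⟨_, rfl, h1, h2⟩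
  rw [Finset.card_insert_of_notMem hvs, hcard] at h3
  omega

/-! ### Gaussian exponential moments and Chernoff bounds -/

theorem gaussianPDFReal_mul_exp_quadratic {b : ℝ} (hb : b < 1 / 2) (c x : ℝ) :
    gaussianPDFReal 0 1 x * Real.exp (b * x ^ 2 + c * x) =
      (√(1 - 2 * b))⁻¹ * Real.exp (c ^ 2 / (2 * (1 - 2 * b))) *
        gaussianPDFReal (c / (1 - 2 * b)) (1 - 2 * b)⁻¹.toNNReal x := by
  have h : 0 < 1 - 2 * b := by linarith
  have hv : (((1 - 2 * b)⁻¹.toNNReal : NNReal) : ℝ) = (1 - 2 * b)⁻¹ :=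
    Real.coe_toNNReal _ (by positivity)
  rw [gaussianPDFReal, gaussianPDFReal, hv]
  have h1 : √(2 * Real.pi * (1 - 2 * b)⁻¹) = √(2 * Real.pi) * (√(1 - 2 * b))⁻¹ := by
    rw [Real.sqrt_mul (by positivity), Real.sqrt_inv]
  have h2 : √(1 - 2 * b) ≠ 0 := (Real.sqrt_pos.2 h).ne'
  rw [h1, mul_inv, inv_inv, mul_assoc, ← Real.exp_add]
  have h3 : ∀ u w y z : ℝ, u⁻¹ * Real.exp y * (z * (u * Real.exp w)) =
      (u⁻¹ * u) * (z * Real.exp (y + w)) := by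
    intro u w y z; rw [Real.exp_add]; ring
  rw [mul_comm (√(2 * Real.pi))⁻¹ (√(1 - 2 * b)), mul_assoc (√(1 - 2 * b)),
    mul_left_comm (√(1 - 2 * b)), h3, inv_mul_cancel₀ h2, one_mul]
  simp only [NNReal.coe_one, mul_one]
  congr 2
  field_simp
  ring

theorem integrable_exp_quadratic_gaussianReal {b : ℝ} (hb : b < 1 / 2) (c : ℝ) :
    Integrable (fun x => Real.exp (b * x ^ 2 + c * x)) (gaussianReal 0 1) := by
  rw [gaussianReal_of_var_ne_zero _ one_ne_zero,
    integrable_withDensity_iff_integrable_smul' (measurable_gaussianPDF 0 1)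
      (ae_of_all _ fun x => gaussianPDF_lt_top)]
  simp only [toReal_gaussianPDF, smul_eq_mul, gaussianPDFReal_mul_exp_quadratic hb]
  exact (integrable_gaussianPDFReal _ _).const_mul _

theorem integral_exp_quadratic_gaussianReal {b : ℝ} (hb : b < 1 / 2) (c : ℝ) :
    ∫ x, Real.exp (b * x ^ 2 + c * x) ∂gaussianReal 0 1 =
      (√(1 - 2 * b))⁻¹ * Real.exp (c ^ 2 / (2 * (1 - 2 * b))) := by
  have h : 0 < (1 - 2 * b)⁻¹ := inv_pos.2 (by linarith)
  rw [integral_gaussianReal_eq_integral_smul one_ne_zero]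
  simp only [smul_eq_mul, gaussianPDFReal_mul_exp_quadratic hb]
  rw [integral_const_mul, integral_gaussianPDFReal_eq_one _ (by simpa using h), mul_one]

/-- Used at x = -2l with |l| ≤ 1/4, where it bounds (1 - 2l)^(-1/2) by exp(l + 4l²). -/
theorem exp_sub_two_mul_sq_le_one_add {x : ℝ} (hx : -(1 / 2) ≤ x) :
    Real.exp (x - 2 * x ^ 2) ≤ 1 + x := by
  have h : 0 < 1 + x := by linarith
  rw [← Real.le_log_iff_exp_le h]
  refine le_trans ?_ (Real.one_sub_inv_le_log_of_pos h)
  have : 1 - (1 + x)⁻¹ - (x - 2 * x ^ 2) = x ^ 2 * (1 + 2 * x) / (1 + x) := by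
    field_simp; ring
  have h2 : 0 ≤ x ^ 2 * (1 + 2 * x) / (1 + x) := by
    have : 0 ≤ 1 + 2 * x := by linarith
    positivity
  linarith

/-- The centring term exp(-l) cancels the first-order part of (1 - 2l)^(-1/2). Only a quadratic
exponent is left, as for a sub-Gaussian variable in the range |l| ≤ 1/4. -/
theorem integral_exp_chiSquare_le {l : ℝ} (hl : |l| ≤ 1 / 4) (a : ℝ) :
    Integrable (fun x => Real.exp (l * (x ^ 2 - 1 + 2 * a * x))) (gaussianReal 0 1) ∧
    ∫ x, Real.exp (l * (x ^ 2 - 1 + 2 * a * x)) ∂gaussianReal 0 1 ≤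
      Real.exp (4 * l ^ 2 * (1 + a ^ 2)) := by
  obtain ⟨hl1, hl2⟩ := abs_le.1 hl
  have hb : l < 1 / 2 := by linarith
  have h : ∀ x : ℝ, Real.exp (l * (x ^ 2 - 1 + 2 * a * x)) =
      Real.exp (-l) * Real.exp (l * x ^ 2 + 2 * l * a * x) := by
    intro x; rw [← Real.exp_add]; ring_nf
  simp only [h]
  refine ⟨(integrable_exp_quadratic_gaussianReal hb _).const_mul _, ?_⟩
  rw [integral_const_mul, integral_exp_quadratic_gaussianReal hb]
  have h0 : 0 < 1 - 2 * l := by linarith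
  have h1 : (√(1 - 2 * l))⁻¹ ≤ Real.exp (l + 4 * l ^ 2) := by
    rw [inv_le_comm₀ (Real.sqrt_pos.2 h0) (Real.exp_pos _), ← Real.exp_neg]
    apply Real.le_sqrt_of_sq_le
    rw [← Real.exp_nat_mul]
    have := exp_sub_two_mul_sq_le_one_add (x := -(2 * l)) (by linarith)
    refine le_trans (le_of_eq ?_) (this.trans (by linarith))
    congr 1
    push_cast
    ring
  have h2 : (2 * l * a) ^ 2 / (2 * (1 - 2 * l)) ≤ 4 * l ^ 2 * a ^ 2 := by
    rw [div_le_iff₀ (by positivity)]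
    have : 0 ≤ (l * a) ^ 2 * (1 - 4 * l) := mul_nonneg (sq_nonneg _) (by linarith)
    nlinarith
  calc _ ≤ Real.exp (-l) * (Real.exp (l + 4 * l ^ 2) * Real.exp (4 * l ^ 2 * a ^ 2)) := by
        gcongr
    _ = _ := by rw [← Real.exp_add, ← Real.exp_add]; ring_nf

/-- The form of the bound is stable under products, so it can be applied to the entries of a row and
then to the rows. -/
theorem integral_exp_sum_pi_le {ι : Type*} [Fintype ι] {X : Type*} [MeasurableSpace X]
    (μ : Measure X) [SigmaFinite μ] (f : ι → X → ℝ) (k : ι → ℝ) (l : ℝ)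
    (h : ∀ i, Integrable (fun x => Real.exp (l * f i x)) μ ∧
      ∫ x, Real.exp (l * f i x) ∂μ ≤ Real.exp (4 * l ^ 2 * k i)) :
    Integrable (fun x : ι → X => Real.exp (l * ∑ i, f i (x i))) (Measure.pi fun _ => μ) ∧
    ∫ x : ι → X, Real.exp (l * ∑ i, f i (x i)) ∂(Measure.pi fun _ => μ) ≤
      Real.exp (4 * l ^ 2 * ∑ i, k i) := by
  simp only [Finset.mul_sum, Real.exp_sum]
  refine ⟨Integrable.fintype_prod fun i => (h i).1, ?_⟩
  rw [integral_fintype_prod_eq_prod (fun i x => Real.exp (l * f i x))]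
  exact Finset.prod_le_prod (fun i _ => integral_nonneg fun x => (Real.exp_pos _).le)
    fun i _ => (h i).2

/-- Rotation invariance of the Gaussian, by characteristic functions; it turns each `E i ⬝ᵥ v` into
one standard normal variable. -/
theorem map_dotProduct_pi_gaussianReal {ι : Type*} [Fintype ι] (v : ι → ℝ)
    (hv : ∑ i, v i ^ 2 = 1) :
    (Measure.pi fun _ : ι => gaussianReal 0 1).map (fun x => x ⬝ᵥ v) = gaussianReal 0 1 := by
  have hm : Measurable fun x : ι → ℝ => x ⬝ᵥ v := by
    unfold dotProduct; fun_prop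
  have : IsProbabilityMeasure
      ((Measure.pi fun _ : ι => gaussianReal 0 1).map (fun x => x ⬝ᵥ v)) :=
    Measure.isProbabilityMeasure_map hm.aemeasurable
  apply Measure.ext_of_charFun
  ext t
  rw [charFun_apply_real, integral_map hm.aemeasurable (by fun_prop), charFun_gaussianReal]
  have h1 : ∀ x : ι → ℝ, Complex.exp (t * ((x ⬝ᵥ v : ℝ) : ℂ) * Complex.I) =
      ∏ i, Complex.exp (((t * v i : ℝ) : ℂ) * x i * Complex.I) := by
    intro x
    rw [← Complex.exp_sum, dotProduct]
    push_cast
    rw [Finset.mul_sum, Finset.sum_mul]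
    congr 1
    exact Finset.sum_congr rfl fun i _ => by ring
  simp only [h1]
  rw [integral_fintype_prod_eq_prod
    (fun i (x : ℝ) => Complex.exp (((t * v i : ℝ) : ℂ) * x * Complex.I))]
  simp only [← charFun_apply_real, charFun_gaussianReal]
  rw [← Complex.exp_sum]
  congr 1
  have h2 : (∑ i, (v i : ℂ) ^ 2) = 1 := by exact_mod_cast hv
  simp only [Complex.ofReal_zero, mul_zero, zero_mul, zero_sub, NNReal.coe_one, Complex.ofReal_one,
    one_mul, Complex.ofReal_mul, mul_pow]
  rw [Finset.sum_neg_distrib, ← Finset.sum_div, ← Finset.mul_sum, h2, mul_one]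

/-- Two-sided Chernoff bound at parameters `±l`. -/
theorem measureReal_abs_ge_le {Ω : Type*} [MeasurableSpace Ω] (μ : Measure Ω) [IsFiniteMeasure μ]
    (X : Ω → ℝ) {l B t : ℝ} (hl : 0 ≤ l)
    (h1 : Integrable (fun w => Real.exp (l * X w)) μ ∧ ∫ w, Real.exp (l * X w) ∂μ ≤ Real.exp B)
    (h2 : Integrable (fun w => Real.exp (-l * X w)) μ ∧
      ∫ w, Real.exp (-l * X w) ∂μ ≤ Real.exp B) :
    μ.real {w | t ≤ |X w|} ≤ 2 * Real.exp (B - l * t) := by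
  have hsub : {w | t ≤ |X w|} ⊆ {w | t ≤ X w} ∪ {w | X w ≤ -t} := by
    intro w hw
    rcases le_abs.1 (show t ≤ |X w| from hw) with h | h
    · exact Or.inl h
    · exact Or.inr (by simp only [Set.mem_ofPred_eq]; linarith)
  have e1 := measure_ge_le_exp_mul_mgf (X := X) t hl h1.1
  have e2 := measure_le_le_exp_mul_mgf (X := X) (-t) (neg_nonpos.2 hl) h2.1
  have f1 : Real.exp (-l * t) * mgf X μ l ≤ Real.exp (B - l * t) := by
    rw [sub_eq_neg_add, Real.exp_add, neg_mul]; gcongr; exact h1.2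
  have f2 : Real.exp (- -l * -t) * mgf X μ (-l) ≤ Real.exp (B - l * t) := by
    rw [sub_eq_neg_add, Real.exp_add, neg_neg, mul_neg]; gcongr; exact h2.2
  calc _ ≤ _ := measureReal_mono hsub
    _ ≤ _ := measureReal_union_le _ _
    _ ≤ _ := by linarith

/-- Chernoff at l = √(m/K)/4, admissible because m ≤ K: then 4l²K = m/4 and l·k√(mK) = km/4. The
parameter m is the exponent wanted: q to beat the net, 1 for the trace. -/
theorem measureReal_abs_ge_sqrt_le {Ω : Type*} [MeasurableSpace Ω] (μ : Measure Ω)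
    [IsFiniteMeasure μ] (X : Ω → ℝ) {K m k : ℝ} (hK : 0 < K) (hm : 0 ≤ m) (hmK : m ≤ K)
    (h : ∀ l : ℝ, |l| ≤ 1 / 4 → Integrable (fun w => Real.exp (l * X w)) μ ∧
      ∫ w, Real.exp (l * X w) ∂μ ≤ Real.exp (4 * l ^ 2 * K)) :
    μ.real {w | k * √(m * K) ≤ |X w|} ≤ 2 * Real.exp (-((k - 1) * m / 4)) := by
  have h0 : 0 ≤ √(m / K) := Real.sqrt_nonneg _
  have h1 : √(m / K) ≤ 1 := Real.sqrt_le_one.2 ((div_le_one hK).2 hmK)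
  have hsq : √(m / K) ^ 2 = m / K := Real.sq_sqrt (by positivity)
  have hl : |√(m / K) / 4| ≤ 1 / 4 := by rw [abs_of_nonneg (by positivity)]; linarith
  have hB : 4 * (√(m / K) / 4) ^ 2 * K = m / 4 := by
    rw [div_pow, hsq]; field_simp
  have e1 := h _ hl
  have e2 := h (-(√(m / K) / 4)) (by rwa [abs_neg])
  rw [neg_sq] at e2
  rw [hB] at e1 e2
  refine (measureReal_abs_ge_le μ X (t := k * √(m * K)) (by positivity) e1 e2).trans
    (le_of_eq ?_)
  have hp : √(m / K) * √(m * K) = m := by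
    rw [← Real.sqrt_mul (by positivity), ← Real.sqrt_sq hm]
    congr 1
    field_simp
    rw [Real.sqrt_sq hm]
  congr 2
  linear_combination (-k / 4) * hp

/-! ### Concentration of the Gram matrix and of its trace -/

instance isProbabilityMeasure_noiseLaw (p q : ℕ) : IsProbabilityMeasure (noiseLaw p q) := by
  unfold noiseLaw
  exact inferInstanceAs (IsProbabilityMeasure
    (Measure.pi fun _ : Fin p => Measure.pi fun _ : Fin q => gaussianReal 0 1))

variable {p q : ℕ}

theorem integral_exp_frobenius_le (A : Matrix (Fin p) (Fin q) ℝ) {l : ℝ} (hl : |l| ≤ 1 / 4) :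
    Integrable (fun E => Real.exp (l * ∑ i, ∑ j, (E i j ^ 2 - 1 + 2 * A i j * E i j)))
      (noiseLaw p q) ∧
    ∫ E, Real.exp (l * ∑ i, ∑ j, (E i j ^ 2 - 1 + 2 * A i j * E i j)) ∂noiseLaw p q ≤
      Real.exp (4 * l ^ 2 * ((p : ℝ) * q + ∑ i, ∑ j, A i j ^ 2)) := by
  have h := integral_exp_sum_pi_le (Measure.pi fun _ : Fin q => gaussianReal 0 1)
    (fun (i : Fin p) (x : Fin q → ℝ) => ∑ j, (x j ^ 2 - 1 + 2 * A i j * x j))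
    (fun i => ∑ j, (1 + A i j ^ 2)) l
    (fun i => integral_exp_sum_pi_le (gaussianReal 0 1)
      (fun (j : Fin q) (x : ℝ) => x ^ 2 - 1 + 2 * A i j * x) (fun j => 1 + A i j ^ 2) l
      (fun j => integral_exp_chiSquare_le hl (A i j)))
  have e : ∑ i : Fin p, ∑ j : Fin q, (1 + A i j ^ 2) = (p : ℝ) * q + ∑ i, ∑ j, A i j ^ 2 := by
    simp [Finset.sum_add_distrib]
  rw [e] at h
  exact h

theorem integral_exp_quadForm_le (a : Fin p → ℝ) {v : Fin q → ℝ} (hv : ∑ j, v j ^ 2 = 1)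
    {l K : ℝ} (hl : |l| ≤ 1 / 4) (hK : p + ∑ i, a i ^ 2 ≤ K) :
    Integrable (fun E : Matrix (Fin p) (Fin q) ℝ =>
      Real.exp (l * ∑ i, ((E i ⬝ᵥ v) ^ 2 - 1 + 2 * a i * (E i ⬝ᵥ v)))) (noiseLaw p q) ∧
    ∫ E : Matrix (Fin p) (Fin q) ℝ,
      Real.exp (l * ∑ i, ((E i ⬝ᵥ v) ^ 2 - 1 + 2 * a i * (E i ⬝ᵥ v))) ∂noiseLaw p q ≤
      Real.exp (4 * l ^ 2 * K) := by
  have hm : Measurable fun x : Fin q → ℝ => x ⬝ᵥ v := by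
    unfold dotProduct; fun_prop
  have h1 : ∀ i : Fin p,
      Integrable (fun x : Fin q → ℝ => Real.exp (l * ((x ⬝ᵥ v) ^ 2 - 1 + 2 * a i * (x ⬝ᵥ v))))
        (Measure.pi fun _ : Fin q => gaussianReal 0 1) ∧
      ∫ x : Fin q → ℝ, Real.exp (l * ((x ⬝ᵥ v) ^ 2 - 1 + 2 * a i * (x ⬝ᵥ v)))
        ∂(Measure.pi fun _ : Fin q => gaussianReal 0 1) ≤ Real.exp (4 * l ^ 2 * (1 + a i ^ 2)) := by
    intro i
    have h := integral_exp_chiSquare_le hl (a i)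
    rw [← map_dotProduct_pi_gaussianReal v hv,
      integrable_map_measure (by fun_prop) hm.aemeasurable,
      integral_map hm.aemeasurable (by fun_prop)] at h
    exact h
  have h := integral_exp_sum_pi_le (Measure.pi fun _ : Fin q => gaussianReal 0 1)
    (fun (i : Fin p) (x : Fin q → ℝ) => (x ⬝ᵥ v) ^ 2 - 1 + 2 * a i * (x ⬝ᵥ v))
    (fun i => 1 + a i ^ 2) l h1
  refine ⟨h.1, h.2.trans (Real.exp_le_exp.2 ?_)⟩
  refine mul_le_mul_of_nonneg_left ?_ (by positivity)
  simpa [Finset.sum_add_distrib] using hK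

/-- The deviation of `YᵀY - p I` from `AᵀA`, where `Y = A + E`. -/
noncomputable def gramError (A E : Matrix (Fin p) (Fin q) ℝ) : Matrix (Fin q) (Fin q) ℝ :=
  (A + E)ᵀ * (A + E) - (p : ℝ) • (1 : Matrix (Fin q) (Fin q) ℝ) - Aᵀ * A

theorem gramError_isSymm (A E : Matrix (Fin p) (Fin q) ℝ) : (gramError A E).IsSymm := by
  simp [Matrix.IsSymm, gramError, Matrix.transpose_sub, Matrix.transpose_mul,
    Matrix.transpose_smul]

theorem gramError_quadForm (A E : Matrix (Fin p) (Fin q) ℝ) {v : Fin q → ℝ}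
    (hv : ∑ j, v j ^ 2 = 1) :
    v ⬝ᵥ (gramError A E *ᵥ v) =
      ∑ i, ((E i ⬝ᵥ v) ^ 2 - 1 + 2 * (A *ᵥ v) i * (E i ⬝ᵥ v)) := by
  have hq : ∀ B : Matrix (Fin p) (Fin q) ℝ, v ⬝ᵥ ((Bᵀ * B) *ᵥ v) = ∑ i, (B *ᵥ v) i ^ 2 := by
    intro B
    rw [← Matrix.mulVec_mulVec, Matrix.dotProduct_mulVec, Matrix.vecMul_transpose, dotProduct]
    exact Finset.sum_congr rfl fun i _ => (sq _).symm
  have hvv : v ⬝ᵥ v = 1 := by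
    rw [← hv]; exact Finset.sum_congr rfl fun i _ => (sq _).symm
  rw [gramError, Matrix.sub_mulVec, Matrix.sub_mulVec, dotProduct_sub, dotProduct_sub, hq, hq,
    Matrix.smul_mulVec, Matrix.one_mulVec, dotProduct_smul, hvv, Matrix.add_mulVec]
  have hp : (p : ℝ) • (1 : ℝ) = ∑ _i : Fin p, (1 : ℝ) := by simp
  rw [hp, ← Finset.sum_sub_distrib, ← Finset.sum_sub_distrib]
  refine Finset.sum_congr rfl fun i _ => ?_
  have : (E *ᵥ v) i = E i ⬝ᵥ v := rfl
  rw [Pi.add_apply, this]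
  ring

theorem gramError_trace (A E : Matrix (Fin p) (Fin q) ℝ) :
    ((A + E)ᵀ * (A + E) - (p : ℝ) • (1 : Matrix (Fin q) (Fin q) ℝ)).trace -
      ∑ i, ∑ j, A i j ^ 2 = ∑ i, ∑ j, (E i j ^ 2 - 1 + 2 * A i j * E i j) := by
  have h : ((A + E)ᵀ * (A + E)).trace = ∑ i, ∑ j, (A i j + E i j) ^ 2 := by
    rw [Matrix.trace, Finset.sum_comm]
    refine Finset.sum_congr rfl fun j _ => ?_
    rw [Matrix.diag_apply, Matrix.mul_apply]
    exact Finset.sum_congr rfl fun i _ => by simp [sq]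
  have hp : (p : ℝ) * q = ∑ _i : Fin p, ∑ _j : Fin q, (1 : ℝ) := by simp
  rw [Matrix.trace_sub, Matrix.trace_smul, Matrix.trace_one, h, Fintype.card_fin, smul_eq_mul, hp]
  simp only [← Finset.sum_sub_distrib]
  exact Finset.sum_congr rfl fun i _ => Finset.sum_congr rfl fun j _ => by ring

/-- With m = q and k = 9 + 4L each net point fails with probability at most 2exp(-(2 + L)q). The 5^q
≤ exp(2q) points use up the 2, and q ≥ 1 does the rest. -/
theorem noiseLaw_real_gramError_ge_le (A : Matrix (Fin p) (Fin q) ℝ) (hq : 0 < q) (hqp : q ≤ p)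
    {L : ℝ} (hL : 0 ≤ L) :
    (noiseLaw p q).real {E | 2 * ((9 + 4 * L) * √(q * (p + sv A 0 ^ 2))) < sv (gramError A E) 0} ≤
      2 * Real.exp (-L) := by
  obtain ⟨s, hcard, hs, hnet⟩ := exists_net_card_le q
  have hq1 : (1 : ℝ) ≤ q := by exact_mod_cast hq
  have hqp' : (q : ℝ) ≤ p := by exact_mod_cast hqp
  set t := (9 + 4 * L) * √(q * (p + sv A 0 ^ 2)) with ht
  have hsub : {E | 2 * t < sv (gramError A E) 0} ⊆
      ⋃ v ∈ s, {E | t ≤ |v.ofLp ⬝ᵥ (gramError A E *ᵥ v.ofLp)|} := by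
    intro E hE
    by_contra hcon
    simp only [Set.mem_iUnion, Set.mem_ofPred_eq, exists_prop, not_exists, not_and, not_le] at hcon
    exact absurd (sv_zero_le_of_net (gramError_isSymm A E) hq hs hnet fun v hv => (hcon v hv).le)
      (not_le.2 hE)
  have hone : ∀ v ∈ s, (noiseLaw p q).real {E | t ≤ |v.ofLp ⬝ᵥ (gramError A E *ᵥ v.ofLp)|} ≤
      2 * Real.exp (-((9 + 4 * L - 1) * q / 4)) := by
    intro v hv
    have hv1 : ∑ j, v.ofLp j ^ 2 = 1 := by
      rw [← EuclideanSpace.real_norm_sq_eq, hs v hv, one_pow]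
    simp only [gramError_quadForm A _ hv1]
    refine measureReal_abs_ge_sqrt_le (noiseLaw p q) _ ?_ (by positivity) ?_ ?_
    · nlinarith [sq_nonneg (sv A 0)]
    · nlinarith [sq_nonneg (sv A 0)]
    · intro l hl
      refine integral_exp_quadForm_le (A *ᵥ v.ofLp) hv1 hl ?_
      have := sum_sq_mulVec_le A v.ofLp
      rw [hv1, mul_one] at this
      linarith
  calc _ ≤ _ := measureReal_mono hsub (measure_ne_top _ _)
    _ ≤ _ := measureReal_biUnion_finset_le s _
    _ ≤ _ := Finset.sum_le_sum hone
    _ = s.card * (2 * Real.exp (-((9 + 4 * L - 1) * q / 4))) := by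
        rw [Finset.sum_const, nsmul_eq_mul]
    _ ≤ Real.exp (2 * q) * (2 * Real.exp (-((9 + 4 * L - 1) * q / 4))) := by
        gcongr
        have h5 : (5 : ℝ) ≤ Real.exp 2 := by
          have := Real.exp_one_gt_d9
          have h2 : Real.exp 2 = Real.exp 1 * Real.exp 1 := by rw [← Real.exp_add]; norm_num
          nlinarith
        calc (s.card : ℝ) ≤ 5 ^ q := by exact_mod_cast hcard
          _ ≤ Real.exp 2 ^ q := by gcongr
          _ = Real.exp (2 * q) := by rw [← Real.exp_nat_mul]; ring_nf
    _ = 2 * Real.exp (-(L * q)) := by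
        rw [mul_left_comm, ← Real.exp_add]; ring_nf
    _ ≤ _ := by
        gcongr
        nlinarith

theorem noiseLaw_real_trace_ge_le (A : Matrix (Fin p) (Fin q) ℝ) (hq : 0 < q) (hqp : q ≤ p)
    {L : ℝ} :
    (noiseLaw p q).real {E | (9 + 4 * L) * √(p * q + ∑ i, ∑ j, A i j ^ 2) ≤
      |((A + E)ᵀ * (A + E) - (p : ℝ) • (1 : Matrix (Fin q) (Fin q) ℝ)).trace -
        ∑ i, ∑ j, A i j ^ 2|} ≤ 2 * Real.exp (-L) := by
  have hq1 : (1 : ℝ) ≤ q := by exact_mod_cast hq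
  have hp1 : (1 : ℝ) ≤ p := by exact_mod_cast (hq.trans_le hqp)
  have hS : 0 ≤ ∑ i, ∑ j, A i j ^ 2 := by positivity
  have hpq : 1 ≤ (p : ℝ) * q := by nlinarith
  have h := measureReal_abs_ge_sqrt_le (noiseLaw p q)
    (fun E => ∑ i, ∑ j, (E i j ^ 2 - 1 + 2 * A i j * E i j))
    (K := p * q + ∑ i, ∑ j, A i j ^ 2) (m := 1) (k := 9 + 4 * L) (by linarith) zero_le_one
    (by linarith) (fun l hl => integral_exp_frobenius_le A hl)
  simp only [gramError_trace]
  rw [one_mul] at h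
  refine h.trans ?_
  gcongr
  linarith

/-! ### Perturbation of the quotient and the upper bound -/

/-- Truncation at 1 does no harm, since S/s² ≥ 1 and max(·, 1) is 1-Lipschitz. Over the common
denominator the errors of T and D contribute k and 2k. The √S term is absorbed by s ≤ √S and 1 ≤ b,
and D ≥ s²/2 doubles the total to 6k. -/
theorem relative_error_le {k a b s S T D : ℝ} (hk : 0 ≤ k) (ha : 0 ≤ a) (hb : 1 ≤ b) (hs : 0 < s)
    (hsmall : 2 * k * (a + b * s) ≤ s ^ 2 / 2) (hS : s ^ 2 ≤ S)
    (hD : |D - s ^ 2| ≤ 2 * k * (a + b * s)) (hT : |T - S| ≤ k * (a + √S)) :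
    |max (T / D) 1 - S / s ^ 2| / (S / s ^ 2) ≤ 6 * k * (a / s ^ 2 + b / s) := by
  have hs2 : 0 < s ^ 2 := by positivity
  have hS0 : 0 < S := hs2.trans_le hS
  have hD2 : s ^ 2 / 2 ≤ D := by linarith [(abs_le.1 hD).1]
  have hD0 : 0 < D := by linarith
  have hER : 1 ≤ S / s ^ 2 := (one_le_div hs2).2 hS
  have hmax : |max (T / D) 1 - S / s ^ 2| ≤ |T / D - S / s ^ 2| := by
    conv_lhs => rw [← max_eq_left hER]
    exact abs_max_sub_max_le_abs _ _ _
  have hsq : √S * s ^ 2 ≤ b * s * S := by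
    have h1 : s ≤ √S := Real.le_sqrt_of_sq_le hS
    have h2 : √S * √S = S := Real.mul_self_sqrt hS0.le
    calc √S * s ^ 2 = √S * s * s := by ring
      _ ≤ √S * √S * s := by gcongr
      _ = 1 * s * S := by rw [h2]; ring
      _ ≤ b * s * S := by gcongr
  have hmain : |T / D - S / s ^ 2| ≤ 6 * k * (a + b * s) * S / s ^ 4 := by
    have e : T / D - S / s ^ 2 = ((T - S) * s ^ 2 + S * (s ^ 2 - D)) / (D * s ^ 2) := by
      field_simp; ring
    rw [e, abs_div, abs_of_pos (mul_pos hD0 hs2)]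
    have hnum : |(T - S) * s ^ 2 + S * (s ^ 2 - D)| ≤ 3 * k * (a + b * s) * S := by
      refine (abs_add_le _ _).trans ?_
      rw [abs_mul, abs_mul, abs_of_pos hs2, abs_of_pos hS0, abs_sub_comm (s ^ 2)]
      have h1 : |T - S| * s ^ 2 ≤ k * (a + b * s) * S := by
        calc |T - S| * s ^ 2 ≤ k * (a + √S) * s ^ 2 := by gcongr
          _ = k * (a * s ^ 2 + √S * s ^ 2) := by ring
          _ ≤ k * (a * S + b * s * S) := by gcongr
          _ = _ := by ring
      have h2 := mul_le_mul_of_nonneg_left hD hS0.le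
      linarith
    rw [div_le_div_iff₀ (by positivity) (by positivity)]
    have h0 : 0 ≤ 3 * k * (a + b * s) * S := by positivity
    calc _ ≤ 3 * k * (a + b * s) * S * s ^ 4 := by gcongr
      _ = 6 * k * (a + b * s) * S * (s ^ 2 / 2 * s ^ 2) := by ring
      _ ≤ _ := by gcongr
  rw [div_le_iff₀ (by positivity)]
  refine (hmax.trans hmain).trans (le_of_eq ?_)
  field_simp

theorem sqrt_add_le_add_sqrt {x y : ℝ} (hx : 0 ≤ x) (hy : 0 ≤ y) : √(x + y) ≤ √x + √y := by
  refine Real.sqrt_le_iff.2 ⟨by positivity, ?_⟩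
  nlinarith [Real.sq_sqrt hx, Real.sq_sqrt hy, mul_nonneg (Real.sqrt_nonneg x) (Real.sqrt_nonneg y)]

theorem rpow_quarter_sq {x : ℝ} (hx : 0 ≤ x) : (x ^ ((1 : ℝ) / 4)) ^ 2 = √x := by
  rw [← Real.rpow_natCast, ← Real.rpow_mul hx, Real.sqrt_eq_rpow]
  norm_num

theorem sqrt_le_rpow_quarter {p q : ℕ} (hqp : q ≤ p) :
    √(q : ℝ) ≤ ((p : ℝ) * q) ^ ((1 : ℝ) / 4) := by
  have hqp' : (q : ℝ) ≤ p := by exact_mod_cast hqp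
  refine le_of_sq_le_sq ?_ (by positivity)
  rw [rpow_quarter_sq (by positivity), Real.sq_sqrt (by positivity)]
  apply Real.le_sqrt_of_sq_le
  nlinarith [Nat.cast_nonneg (α := ℝ) q]

theorem measurable_entry {p q : ℕ} (i : Fin p) (j : Fin q) :
    Measurable fun E : Matrix (Fin p) (Fin q) ℝ => E i j := by
  change Measurable fun E : Fin p → Fin q → ℝ => E i j
  fun_prop

theorem measurable_const_add_matrix {p q : ℕ} (A : Matrix (Fin p) (Fin q) ℝ) :
    Measurable fun E : Matrix (Fin p) (Fin q) ℝ => A + E :=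
  measurable_pi_lambda _ fun i => measurable_pi_lambda _ fun j =>
    measurable_const.add (measurable_entry i j)

/-- For arbitrary sets this is only an inequality, but in the direction needed, so measurability of
`effRankEst` never enters. -/
theorem obsLaw_apply_ge (A : Matrix (Fin p) (Fin q) ℝ)
    (s : Set (Matrix (Fin p) (Fin q) ℝ)) :
    noiseLaw p q {E | A + E ∈ s} ≤ obsLaw A s := by
  exact Measure.le_map_apply (measurable_const_add_matrix A).aemeasurable s

theorem effRankEst_relative_error_le {p q : ℕ} (hq : 0 < q) (hqp : q ≤ p) {k : ℝ} (hk : 1 ≤ k)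
    {A E : Matrix (Fin p) (Fin q) ℝ}
    (hA : 8 * k * ((p : ℝ) * q) ^ ((1 : ℝ) / 4) ≤ sv A 0)
    (h1 : sv (gramError A E) 0 ≤ 2 * (k * √(q * (p + sv A 0 ^ 2))))
    (h2 : |((A + E)ᵀ * (A + E) - (p : ℝ) • (1 : Matrix (Fin q) (Fin q) ℝ)).trace -
        ∑ i, ∑ j, A i j ^ 2| ≤ k * √(p * q + ∑ i, ∑ j, A i j ^ 2)) :
    |effRankEst (A + E) - effRank A| / effRank A ≤
      6 * k * (√((p : ℝ) * q) / sv A 0 ^ 2 + √(q : ℝ) / sv A 0) := by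
  have hq1 : (1 : ℝ) ≤ q := by exact_mod_cast hq
  have hb : 1 ≤ √(q : ℝ) := Real.one_le_sqrt.2 hq1
  have hS0 : 0 ≤ ∑ i, ∑ j, A i j ^ 2 := by positivity
  set w := ((p : ℝ) * q) ^ ((1 : ℝ) / 4) with hw
  have hbw : √(q : ℝ) ≤ w := sqrt_le_rpow_quarter hqp
  have hw2 : w ^ 2 = √((p : ℝ) * q) := rpow_quarter_sq (by positivity)
  have hs : 0 < sv A 0 := by nlinarith
  rw [effRank_eq, effRankEst, opNorm]
  refine relative_error_le (by linarith) (Real.sqrt_nonneg _) hb hs ?_ (sv_zero_sq_le A hq) ?_ ?_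
  -- Since √q ≤ w ≤ σ₁, the left side is at most 4kwσ₁, and 8kw ≤ σ₁ makes this at most σ₁²/2.
  · rw [← hw2]
    have h3 : √(q : ℝ) * sv A 0 ≤ w * sv A 0 := by gcongr
    have h4 : w ≤ sv A 0 := by nlinarith
    have h5 : w ^ 2 ≤ w * sv A 0 := by nlinarith
    have h6 := mul_le_mul_of_nonneg_right hA hs.le
    have h7 : 2 * k * (w ^ 2 + √(q : ℝ) * sv A 0) ≤ 2 * k * (w * sv A 0 + w * sv A 0) := by
      gcongr
    nlinarith
  · rw [← sv_zero_transpose_mul_self A hq]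
    refine (abs_sv_zero_sub_le _ _ hq).trans (h1.trans ?_)
    have : √(q * (p + sv A 0 ^ 2)) ≤ √((p : ℝ) * q) + √(q : ℝ) * sv A 0 := by
      rw [mul_add]
      refine (sqrt_add_le_add_sqrt (by positivity) (by positivity)).trans (le_of_eq ?_)
      rw [Real.sqrt_mul (Nat.cast_nonneg _) (sv A 0 ^ 2), Real.sqrt_sq hs.le, mul_comm (q : ℝ)]
    nlinarith
  · refine h2.trans ?_
    gcongr
    exact sqrt_add_le_add_sqrt (by positivity) (by positivity)

theorem effRankEst_upper_bound {α : ℝ} (hα : 0 < α) (hα' : α < 1 / 2) :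
    ∃ c > (0 : ℝ), ∃ c' > (0 : ℝ), ∀ p q : ℕ, 2 ≤ q → q ≤ p →
      ∀ A : Matrix (Fin p) (Fin q) ℝ,
        c * ((p : ℝ) * q) ^ ((1 : ℝ) / 4) ≤ sv A 0 →
        ENNReal.ofReal (1 - α) ≤
          obsLaw A {Y : Matrix (Fin p) (Fin q) ℝ |
            |effRankEst Y - effRank A| / effRank A ≤
              c' * (√((p : ℝ) * q) / sv A 0 ^ 2 + √(q : ℝ) / sv A 0)} := by
  -- Each of the two bad events then has probability at most 2exp(-L) = α/2.
  set L := Real.log (4 / α) with hL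
  have hL0 : 0 ≤ L := Real.log_nonneg (by rw [le_div_iff₀ hα]; linarith)
  have hexp : Real.exp (-L) = α / 4 := by
    rw [Real.exp_neg, hL, Real.exp_log (by positivity), inv_div]
  refine ⟨8 * (9 + 4 * L), by positivity, 6 * (9 + 4 * L), by positivity, ?_⟩
  intro p q hq hqp A hA
  have hq0 : 0 < q := by omega
  refine le_trans ?_ (obsLaw_apply_ge A _)
  set G := {E : Matrix (Fin p) (Fin q) ℝ | A + E ∈ {Y : Matrix (Fin p) (Fin q) ℝ |
            |effRankEst Y - effRank A| / effRank A ≤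
              6 * (9 + 4 * L) * (√((p : ℝ) * q) / sv A 0 ^ 2 + √(q : ℝ) / sv A 0)}} with hG
  set B1 := {E | 2 * ((9 + 4 * L) * √(q * (p + sv A 0 ^ 2))) < sv (gramError A E) 0} with hB1
  set B2 := {E | (9 + 4 * L) * √(p * q + ∑ i, ∑ j, A i j ^ 2) ≤
      |((A + E)ᵀ * (A + E) - (p : ℝ) • (1 : Matrix (Fin q) (Fin q) ℝ)).trace -
        ∑ i, ∑ j, A i j ^ 2|} with hB2
  have hcover : Set.univ ⊆ G ∪ (B1 ∪ B2) := by
    intro E _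
    by_cases h1 : E ∈ B1
    · exact Or.inr (Or.inl h1)
    by_cases h2 : E ∈ B2
    · exact Or.inr (Or.inr h2)
    · exact Or.inl (effRankEst_relative_error_le hq0 hqp (by linarith) hA (not_lt.1 h1)
        (not_le.1 h2).le)
  have h1 : (noiseLaw p q).real B1 ≤ 2 * Real.exp (-L) :=
    noiseLaw_real_gramError_ge_le A hq0 hqp hL0
  have h2 : (noiseLaw p q).real B2 ≤ 2 * Real.exp (-L) := noiseLaw_real_trace_ge_le A hq0 hqp
  have h3 : (1 : ℝ) ≤ (noiseLaw p q).real G + ((noiseLaw p q).real B1 + (noiseLaw p q).real B2) := by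
    calc (1 : ℝ) = (noiseLaw p q).real Set.univ := by simp
      _ ≤ _ := measureReal_mono hcover
      _ ≤ _ := measureReal_union_le _ _
      _ ≤ _ := by gcongr; exact measureReal_union_le _ _
  rw [ENNReal.ofReal_le_iff_le_toReal (measure_ne_top _ _)]
  change 1 - α ≤ (noiseLaw p q).real G
  linarith

/-! ### Gaussian shifts, mixtures and Le Cam's method -/

theorem gaussianReal_one_eq_withDensity (d : ℝ) :
    gaussianReal d 1 = (gaussianReal 0 1).withDensity
      fun x => ENNReal.ofReal (Real.exp (d * x - d ^ 2 / 2)) := by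
  rw [gaussianReal_of_var_ne_zero _ one_ne_zero, gaussianReal_of_var_ne_zero _ one_ne_zero,
    ← withDensity_mul _ (measurable_gaussianPDF 0 1) (by fun_prop)]
  congr 1
  ext x
  rw [Pi.mul_apply, gaussianPDF, gaussianPDF, ← ENNReal.ofReal_mul (gaussianPDFReal_nonneg _ _ _),
    gaussianPDFReal, gaussianPDFReal, mul_assoc (√_)⁻¹, ← Real.exp_add]
  congr 3
  push_cast
  ring

theorem pi_withDensity_exp {ι : Type*} [Fintype ι] {X : Type*} [MeasurableSpace X]
    (μ : Measure X) [SigmaFinite μ] (f : ι → X → ℝ)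
    (hint : ∀ i, Integrable (fun x => Real.exp (f i x)) μ) :
    Measure.pi (fun i => μ.withDensity fun x => ENNReal.ofReal (Real.exp (f i x))) =
      (Measure.pi fun _ : ι => μ).withDensity
        fun x => ENNReal.ofReal (Real.exp (∑ i, f i (x i))) := by
  refine Measure.pi_eq fun s hs => ?_
  rw [withDensity_apply _ (MeasurableSet.univ_pi hs), Measure.restrict_pi_pi]
  simp only [Real.exp_sum]
  rw [← ofReal_integral_eq_lintegral_ofReal
      (Integrable.fintype_prod_dep fun i => (hint i).mono_measure Measure.restrict_le_self)
      (ae_of_all _ fun x => Finset.prod_nonneg fun i _ => (Real.exp_pos _).le),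
    integral_fintype_prod_eq_prod (fun i x => Real.exp (f i x)),
    ENNReal.ofReal_prod_of_nonneg
      (fun i _ => integral_nonneg fun x => (Real.exp_pos _).le)]
  refine Finset.prod_congr rfl fun i _ => ?_
  rw [withDensity_apply _ (hs i), ofReal_integral_eq_lintegral_ofReal
    ((hint i).mono_measure Measure.restrict_le_self)
    (ae_of_all _ fun x => (Real.exp_pos _).le)]

theorem integrable_exp_of_isFiniteMeasure_withDensity {X : Type*} [MeasurableSpace X]
    {μ : Measure X} {f : X → ℝ} (hf : Measurable f)
    (h : (μ.withDensity fun x => ENNReal.ofReal (Real.exp (f x))) Set.univ ≠ ∞) :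
    Integrable (fun x => Real.exp (f x)) μ := by
  refine (lintegral_ofReal_ne_top_iff_integrable (by fun_prop)
    (ae_of_all _ fun x => (Real.exp_pos _).le)).1 ?_
  rwa [withDensity_apply _ MeasurableSet.univ, Measure.restrict_univ] at h

/-- The log-likelihood ratio of the shift of the standard Gaussian matrix by `D`. -/
noncomputable def logLik (D E : Matrix (Fin p) (Fin q) ℝ) : ℝ :=
  ∑ i, ∑ j, (D i j * E i j - D i j ^ 2 / 2)

theorem measurable_logLik (D : Matrix (Fin p) (Fin q) ℝ) : Measurable (logLik D) := by
  refine Finset.measurable_sum _ fun i _ => Finset.measurable_sum _ fun j _ => ?_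
  exact (measurable_const.mul (measurable_entry i j)).sub_const _

/-- The Cameron–Martin formula for Gaussian matrices. -/
theorem noiseLaw_map_add (D : Matrix (Fin p) (Fin q) ℝ) :
    (noiseLaw p q).map (fun E => D + E) =
      (noiseLaw p q).withDensity fun E => ENNReal.ofReal (Real.exp (logLik D E)) := by
  have h1 : ∀ d : ℝ, (gaussianReal 0 1).map (fun x => d + x) = (gaussianReal 0 1).withDensity
      fun x => ENNReal.ofReal (Real.exp (d * x - d ^ 2 / 2)) := by
    intro d
    rw [gaussianReal_map_const_add, zero_add, gaussianReal_one_eq_withDensity]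
  have i1 : ∀ d : ℝ, Integrable (fun x => Real.exp (d * x - d ^ 2 / 2)) (gaussianReal 0 1) := by
    intro d
    refine integrable_exp_of_isFiniteMeasure_withDensity (by fun_prop) ?_
    rw [← gaussianReal_one_eq_withDensity]
    exact measure_ne_top _ _
  have h2 : ∀ d : Fin q → ℝ,
      (Measure.pi fun _ : Fin q => gaussianReal 0 1).map (fun x => d + x) =
        (Measure.pi fun _ : Fin q => gaussianReal 0 1).withDensity
          fun x => ENNReal.ofReal (Real.exp (∑ j, (d j * x j - d j ^ 2 / 2))) := by
    intro d
    have hp : ∀ j, IsProbabilityMeasure ((gaussianReal 0 1).map (fun x => d j + x)) :=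
      fun j => Measure.isProbabilityMeasure_map (by fun_prop)
    rw [← pi_withDensity_exp (gaussianReal 0 1) (fun j x => d j * x - d j ^ 2 / 2) (fun j => i1 (d j))]
    simp only [← h1]
    exact Measure.pi_map_pi (μ := fun _ : Fin q => gaussianReal 0 1)
      (f := fun j x => d j + x) (fun j => by fun_prop)
  have m2 : ∀ d : Fin q → ℝ, Measurable fun x : Fin q → ℝ => d + x :=
    fun d => measurable_pi_lambda _ fun j => measurable_const.add (measurable_pi_apply j)
  have i2 : ∀ d : Fin q → ℝ,
      Integrable (fun x : Fin q → ℝ => Real.exp (∑ j, (d j * x j - d j ^ 2 / 2)))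
        (Measure.pi fun _ : Fin q => gaussianReal 0 1) := by
    intro d
    refine integrable_exp_of_isFiniteMeasure_withDensity (by fun_prop) ?_
    rw [← h2]
    have := Measure.isProbabilityMeasure_map
      (μ := Measure.pi fun _ : Fin q => gaussianReal 0 1) (m2 d).aemeasurable
    exact measure_ne_top _ _
  have hp : ∀ i, IsProbabilityMeasure
      ((Measure.pi fun _ : Fin q => gaussianReal 0 1).map (fun x => D i + x)) :=
    fun i => Measure.isProbabilityMeasure_map (m2 _).aemeasurable
  have h3 := pi_withDensity_exp (Measure.pi fun _ : Fin q => gaussianReal 0 1)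
    (fun (i : Fin p) (x : Fin q → ℝ) => ∑ j, (D i j * x j - D i j ^ 2 / 2)) (fun i => i2 (D i))
  refine Eq.trans ?_ h3
  simp only [← h2]
  exact Measure.pi_map_pi (μ := fun _ : Fin p => Measure.pi fun _ : Fin q => gaussianReal 0 1)
      (f := fun i x => D i + x) (fun i => (m2 _).aemeasurable)

theorem integrable_exp_logLik (D : Matrix (Fin p) (Fin q) ℝ) :
    Integrable (fun E => Real.exp (logLik D E)) (noiseLaw p q) := by
  refine integrable_exp_of_isFiniteMeasure_withDensity (measurable_logLik D) ?_
  rw [← noiseLaw_map_add]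
  have := Measure.isProbabilityMeasure_map (μ := noiseLaw p q)
    (measurable_const_add_matrix D).aemeasurable
  exact measure_ne_top _ _

theorem noiseLaw_real_add_mem (D : Matrix (Fin p) (Fin q) ℝ) {s : Set (Matrix (Fin p) (Fin q) ℝ)}
    (hs : MeasurableSet s) :
    (noiseLaw p q).real {E | D + E ∈ s} = ∫ E in s, Real.exp (logLik D E) ∂noiseLaw p q := by
  rw [integral_eq_lintegral_of_nonneg_ae (ae_of_all _ fun x => (Real.exp_pos _).le)
    (integrable_exp_logLik D).aestronglyMeasurable.restrict, ← withDensity_apply _ hs,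
    ← noiseLaw_map_add, Measure.map_apply (measurable_const_add_matrix D) hs]
  rfl

theorem integral_exp_logLik (D : Matrix (Fin p) (Fin q) ℝ) :
    ∫ E, Real.exp (logLik D E) ∂noiseLaw p q = 1 := by
  have := noiseLaw_real_add_mem D MeasurableSet.univ
  simpa using this.symm

/-- The Frobenius inner product. -/
noncomputable def frob (D D' : Matrix (Fin p) (Fin q) ℝ) : ℝ := ∑ i, ∑ j, D i j * D' i j

/-- As the last factor has integral 1, the likelihood ratios of D and D' have mixed moment exp⟨D,
D'⟩. -/
theorem exp_logLik_mul (D D' E : Matrix (Fin p) (Fin q) ℝ) :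
    Real.exp (logLik D E) * Real.exp (logLik D' E) =
      Real.exp (frob D D') * Real.exp (logLik (D + D') E) := by
  rw [← Real.exp_add, ← Real.exp_add, logLik, logLik, logLik, frob]
  simp only [← Finset.sum_add_distrib]
  congr 1
  refine Finset.sum_congr rfl fun i _ => Finset.sum_congr rfl fun j _ => ?_
  rw [Matrix.add_apply]
  ring

section Mixture

variable {ι : Type*} [Fintype ι]

/-- The likelihood ratio of the uniform mixture of the shifts `D i`. -/
noncomputable def mixLik (D : ι → Matrix (Fin p) (Fin q) ℝ) (E : Matrix (Fin p) (Fin q) ℝ) : ℝ :=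
  (Fintype.card ι : ℝ)⁻¹ * ∑ i, Real.exp (logLik (D i) E)

theorem integrable_mixLik (D : ι → Matrix (Fin p) (Fin q) ℝ) :
    Integrable (mixLik D) (noiseLaw p q) :=
  (integrable_finsetSum _ fun i _ => integrable_exp_logLik (D i)).const_mul _

theorem mixLik_sq (D : ι → Matrix (Fin p) (Fin q) ℝ) (E : Matrix (Fin p) (Fin q) ℝ) :
    mixLik D E ^ 2 = ((Fintype.card ι : ℝ)⁻¹) ^ 2 *
      ∑ i, ∑ j, Real.exp (frob (D i) (D j)) * Real.exp (logLik (D i + D j) E) := by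
  rw [mixLik, mul_pow, sq (∑ i, _), Finset.sum_mul_sum]
  simp only [exp_logLik_mul]

theorem integrable_mixLik_sq (D : ι → Matrix (Fin p) (Fin q) ℝ) :
    Integrable (fun E => mixLik D E ^ 2) (noiseLaw p q) := by
  simp only [mixLik_sq]
  exact (integrable_finsetSum _ fun i _ => integrable_finsetSum _ fun j _ =>
    (integrable_exp_logLik _).const_mul _).const_mul _

theorem integral_mixLik [Nonempty ι] (D : ι → Matrix (Fin p) (Fin q) ℝ) :
    ∫ E, mixLik D E ∂noiseLaw p q = 1 := by
  simp only [mixLik]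
  rw [integral_const_mul, integral_finsetSum _ fun i _ => integrable_exp_logLik (D i)]
  simp [integral_exp_logLik]

theorem integral_mixLik_sq (D : ι → Matrix (Fin p) (Fin q) ℝ) :
    ∫ E, mixLik D E ^ 2 ∂noiseLaw p q =
      ((Fintype.card ι : ℝ)⁻¹) ^ 2 * ∑ i, ∑ j, Real.exp (frob (D i) (D j)) := by
  simp only [mixLik_sq]
  rw [integral_const_mul, integral_finsetSum _ fun i _ => integrable_finsetSum _ fun j _ =>
    (integrable_exp_logLik _).const_mul _]
  congr 1
  refine Finset.sum_congr rfl fun i _ => ?_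
  rw [integral_finsetSum _ fun j _ => (integrable_exp_logLik _).const_mul _]
  refine Finset.sum_congr rfl fun j _ => ?_
  rw [integral_const_mul, integral_exp_logLik, mul_one]

/-- Here 34/25 = 1 + (3/5)², so the χ² divergence is at most (3/5)². Cauchy–Schwarz is replaced by
the pointwise bound |y| ≤ (5/6)y² + 3/10. -/
theorem integral_abs_mixLik_sub_one_le [Nonempty ι] (D : ι → Matrix (Fin p) (Fin q) ℝ)
    (h : ((Fintype.card ι : ℝ)⁻¹) ^ 2 * ∑ i, ∑ j, Real.exp (frob (D i) (D j)) ≤ 34 / 25) :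
    ∫ E, |mixLik D E - 1| ∂noiseLaw p q ≤ 3 / 5 := by
  have hle : ∀ E, |mixLik D E - 1| ≤
      (5 / 6) * mixLik D E ^ 2 - (5 / 3) * mixLik D E + (5 / 6 + 3 / 10) := by
    intro E
    have h1 := sq_nonneg (|mixLik D E - 1| - 3 / 5)
    have h2 := sq_abs (mixLik D E - 1)
    nlinarith
  have i1 : Integrable (fun E => (5 / 6) * mixLik D E ^ 2) (noiseLaw p q) :=
    (integrable_mixLik_sq D).const_mul _
  have i2 : Integrable (fun E => (5 / 3) * mixLik D E) (noiseLaw p q) :=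
    (integrable_mixLik D).const_mul _
  have i3 : Integrable (fun E => (5 / 6) * mixLik D E ^ 2 - (5 / 3) * mixLik D E)
    (noiseLaw p q) := i1.sub i2
  calc _ ≤ ∫ E, (5 / 6) * mixLik D E ^ 2 - (5 / 3) * mixLik D E + (5 / 6 + 3 / 10)
        ∂noiseLaw p q :=
        integral_mono ((integrable_mixLik D).sub (integrable_const 1)).abs
          (i3.add (integrable_const _)) hle
    _ ≤ 3 / 5 := by
        rw [integral_add i3 (integrable_const _), integral_sub i1 i2, integral_const_mul,
          integral_const_mul, integral_mixLik, integral_mixLik_sq]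
        rw [integral_const, probReal_univ, one_smul]
        linarith

theorem obsLaw_real (A : Matrix (Fin p) (Fin q) ℝ) {s : Set (Matrix (Fin p) (Fin q) ℝ)}
    (hs : MeasurableSet s) : (obsLaw A).real s = (noiseLaw p q).real {E | A + E ∈ s} := by
  rw [Measure.real, obsLaw, Measure.map_apply (measurable_const_add_matrix A) hs]; rfl

/-- Le Cam's bound for testing a point against a uniform mixture, through the `χ²` divergence. -/
theorem two_fifths_le_testing_error [Nonempty ι] (A : Matrix (Fin p) (Fin q) ℝ)
    (D : ι → Matrix (Fin p) (Fin q) ℝ)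
    (h : ((Fintype.card ι : ℝ)⁻¹) ^ 2 * ∑ i, ∑ j, Real.exp (frob (D i) (D j)) ≤ 34 / 25)
    {s : Set (Matrix (Fin p) (Fin q) ℝ)} (hs : MeasurableSet s) :
    2 / 5 ≤ (obsLaw A).real s + (Fintype.card ι : ℝ)⁻¹ * ∑ i, (obsLaw (A + D i)).real sᶜ := by
  set C : Set (Matrix (Fin p) (Fin q) ℝ) := {E | A + E ∈ sᶜ} with hC
  have hCm : MeasurableSet C := measurable_const_add_matrix A hs.compl
  have h1 : ∀ i, (obsLaw (A + D i)).real sᶜ =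
      ∫ E in C, Real.exp (logLik (D i) E) ∂noiseLaw p q := by
    intro i
    rw [obsLaw_real _ hs.compl, ← noiseLaw_real_add_mem _ hCm]
    simp only [hC, Set.mem_ofPred_eq, add_assoc]
  have h2 : (Fintype.card ι : ℝ)⁻¹ * ∑ i, (obsLaw (A + D i)).real sᶜ =
      ∫ E in C, mixLik D E ∂noiseLaw p q := by
    simp only [h1, mixLik]
    rw [integral_const_mul, integral_finsetSum _ fun i _ =>
      (integrable_exp_logLik (D i)).integrableOn]
  have h3 : (obsLaw A).real s = 1 - (noiseLaw p q).real C := by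
    rw [obsLaw_real _ hs, ← probReal_compl_eq_one_sub hCm]
    congr 1
    ext E
    simp [hC]
  have i0 : Integrable (fun E => mixLik D E - 1) (noiseLaw p q) :=
    (integrable_mixLik D).sub (integrable_const 1)
  have h4 : ∫ E in C, mixLik D E ∂noiseLaw p q - (noiseLaw p q).real C =
      ∫ E in C, (mixLik D E - 1) ∂noiseLaw p q := by
    rw [integral_sub (integrable_mixLik D).integrableOn (integrable_const 1).integrableOn]
    simp
  have h5 : -(3 / 5) ≤ ∫ E in C, (mixLik D E - 1) ∂noiseLaw p q := by
    have e1 := abs_integral_le_integral_abs (f := fun E => mixLik D E - 1)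
      (μ := (noiseLaw p q).restrict C)
    have e2 := setIntegral_le_integral (s := C) i0.abs (ae_of_all _ fun E => abs_nonneg _)
    have e3 := integral_abs_mixLik_sub_one_le D h
    have e4 := neg_abs_le (∫ E in C, (mixLik D E - 1) ∂noiseLaw p q)
    linarith
  rw [h2, h3]
  linarith

instance isProbabilityMeasure_obsLaw (A : Matrix (Fin p) (Fin q) ℝ) :
    IsProbabilityMeasure (obsLaw A) :=
  Measure.isProbabilityMeasure_map (measurable_const_add_matrix A).aemeasurable

/-- An estimator yields a test: reject `A` when R misses e₀ by relative error η. When it does not,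
`hsep` forces R to miss e₁. Risks below 1/5 throughout would contradict the total testing error 2/5.
-/
theorem one_fifth_le_minimax_risk [Nonempty ι] (A : Matrix (Fin p) (Fin q) ℝ)
    (D : ι → Matrix (Fin p) (Fin q) ℝ)
    (h : ((Fintype.card ι : ℝ)⁻¹) ^ 2 * ∑ i, ∑ j, Real.exp (frob (D i) (D j)) ≤ 34 / 25)
    {r η e₀ e₁ : ℝ} (hA : r ≤ sv A 0) (hD : ∀ i, r ≤ sv (A + D i) 0)
    (he₀ : effRank A = e₀) (he₁ : ∀ i, effRank (A + D i) = e₁) (h₀ : 0 < e₀) (h₁ : 0 < e₁)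
    (hsep : η * (e₀ + e₁) ≤ |e₀ - e₁|) {R : Matrix (Fin p) (Fin q) ℝ → ℝ} (hR : Measurable R) :
    ENNReal.ofReal (1 / 5) ≤
      ⨆ (A : Matrix (Fin p) (Fin q) ℝ) (_ : r ≤ sv A 0),
        obsLaw A {Y : Matrix (Fin p) (Fin q) ℝ | η ≤ |R Y - effRank A| / effRank A} := by
  by_contra! hcon
  have hlt : ∀ B : Matrix (Fin p) (Fin q) ℝ, r ≤ sv B 0 →
      (obsLaw B).real {Y : Matrix (Fin p) (Fin q) ℝ | η ≤ |R Y - effRank B| / effRank B} <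
        1 / 5 := by
    intro B hB
    have h2 := (le_iSup₂ (f := fun (A : Matrix (Fin p) (Fin q) ℝ) (_ : r ≤ sv A 0) =>
      obsLaw A {Y : Matrix (Fin p) (Fin q) ℝ | η ≤ |R Y - effRank A| / effRank A}) B hB).trans_lt
      hcon
    exact (ENNReal.lt_ofReal_iff_toReal_lt (measure_ne_top _ _)).1 h2
  set s : Set (Matrix (Fin p) (Fin q) ℝ) := {Y | η ≤ |R Y - e₀| / e₀} with hs
  have hsm : MeasurableSet s :=
    measurableSet_le measurable_const (((hR.sub_const e₀).abs).div_const e₀)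
  have h3 := hlt A hA
  rw [he₀] at h3
  have h4 : ∀ i, (obsLaw (A + D i)).real sᶜ ≤ 1 / 5 := by
    intro i
    refine (measureReal_mono (fun Y hY => ?_)).trans (hlt (A + D i) (hD i)).le
    have hY' : |R Y - e₀| / e₀ < η := not_le.1 hY
    rw [div_lt_iff₀ h₀] at hY'
    rw [Set.mem_ofPred_eq, he₁, le_div_iff₀ h₁]
    have := abs_sub_le e₀ (R Y) e₁
    rw [abs_sub_comm e₀ (R Y)] at this
    linarith
  have h5 : (Fintype.card ι : ℝ)⁻¹ * ∑ i, (obsLaw (A + D i)).real sᶜ ≤ 1 / 5 := by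
    rw [inv_mul_le_iff₀ (by positivity)]
    refine (Finset.sum_le_sum fun i _ => h4 i).trans (le_of_eq ?_)
    simp
  have h6 := two_fifths_le_testing_error A D h hsm
  linarith

end Mixture

/-! ### Exponential moments of random signs -/

section Signs

/-- The sign encoded by a Boolean. -/
noncomputable def sgn (b : Bool) : ℝ := if b then 1 else -1

theorem sgn_mul_self (b : Bool) : sgn b * sgn b = 1 := by cases b <;> simp [sgn]

theorem sgn_sq (b : Bool) : sgn b ^ 2 = 1 := by rw [sq, sgn_mul_self]

variable {κ : Type*} [Fintype κ] [DecidableEq κ]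

theorem sum_exp_signs (a : ℝ) (e : κ → Bool) :
    ∑ e' : κ → Bool, Real.exp (a * ∑ k, sgn (e k) * sgn (e' k)) =
      (2 * Real.cosh a) ^ Fintype.card κ := by
  simp only [Finset.mul_sum, Real.exp_sum]
  have h := (Finset.prod_univ_sum (fun _ : κ => (Finset.univ : Finset Bool))
    (fun k b => Real.exp (a * (sgn (e k) * sgn b)))).symm
  rw [Fintype.piFinset_univ] at h
  rw [h, ← Finset.card_univ, ← Finset.prod_const]
  refine Finset.prod_congr rfl fun k _ => ?_
  rw [Real.cosh_eq]
  cases e k <;> simp [sgn] <;> ring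

theorem mean_exp_signs_le (a : ℝ) :
    ((Fintype.card (κ → Bool) : ℝ)⁻¹) ^ 2 *
      ∑ e : κ → Bool, ∑ e' : κ → Bool, Real.exp (a * ∑ k, sgn (e k) * sgn (e' k)) ≤
    Real.exp (Fintype.card κ * (a ^ 2 / 2)) := by
  simp only [sum_exp_signs, Finset.sum_const, Finset.card_univ, nsmul_eq_mul]
  have hN : (Fintype.card (κ → Bool) : ℝ) = 2 ^ Fintype.card κ := by simp
  rw [hN, mul_pow, sq, mul_assoc]
  have h2 : (2 : ℝ) ^ Fintype.card κ ≠ 0 := by positivity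
  rw [Real.exp_nat_mul]
  refine le_of_eq_of_le (b := Real.cosh a ^ Fintype.card κ) (by field_simp) ?_
  exact pow_le_pow_left₀ (Real.cosh_pos a).le (Real.cosh_le_exp_half_sq a) _

/-- Gaussian linearization: exp(S²/(9n)) is the mean of exp(cSx) over standard normal x, with c² =
2/(9n). Summing over signs first gives (2cosh(cx))^n ≤ 2^n exp(x²/9), whose mean is 2^n √(9/7). -/
theorem sum_exp_sq_signs_le [Nonempty κ] (e : κ → Bool) :
    ∑ e' : κ → Bool, Real.exp ((∑ k, sgn (e k) * sgn (e' k)) ^ 2 / (9 * Fintype.card κ)) ≤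
      2 ^ Fintype.card κ * (34 / 25) := by
  set n := Fintype.card κ with hn
  have hn0 : (0 : ℝ) < n := by exact_mod_cast Fintype.card_pos
  set c := √(2 / (9 * n)) with hc
  have hc2 : c ^ 2 = 2 / (9 * n) := Real.sq_sqrt (by positivity)
  have hsum : ∀ x : ℝ, ∑ e' : κ → Bool, Real.exp (0 * x ^ 2 +
      (c * ∑ k, sgn (e k) * sgn (e' k)) * x) = (2 * Real.cosh (c * x)) ^ n := by
    intro x
    rw [← sum_exp_signs (c * x) e]
    refine Finset.sum_congr rfl fun e' _ => ?_
    congr 1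
    ring
  have hint : ∀ e' : κ → Bool, Integrable (fun x => Real.exp (0 * x ^ 2 +
      (c * ∑ k, sgn (e k) * sgn (e' k)) * x)) (gaussianReal 0 1) :=
    fun e' => integrable_exp_quadratic_gaussianReal (by norm_num) _
  calc _ = ∑ e' : κ → Bool, ∫ x, Real.exp (0 * x ^ 2 +
        (c * ∑ k, sgn (e k) * sgn (e' k)) * x) ∂gaussianReal 0 1 := by
        refine Finset.sum_congr rfl fun e' _ => ?_
        rw [integral_exp_quadratic_gaussianReal (by norm_num), mul_pow, hc2]
        simp only [mul_zero, sub_zero, Real.sqrt_one, inv_one, one_mul, mul_one]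
        congr 1
        field_simp
    _ = ∫ x, (2 * Real.cosh (c * x)) ^ n ∂gaussianReal 0 1 := by
        rw [← integral_finsetSum _ fun e' _ => hint e']
        simp only [hsum]
    _ ≤ ∫ x, 2 ^ n * Real.exp (1 / 9 * x ^ 2 + 0 * x) ∂gaussianReal 0 1 := by
        refine integral_mono ?_
          ((integrable_exp_quadratic_gaussianReal (by norm_num) _).const_mul _) fun x => ?_
        · simp only [← hsum]
          exact integrable_finsetSum _ fun e' _ => hint e'
        · have h1 := pow_le_pow_left₀ (Real.cosh_pos _).le (Real.cosh_le_exp_half_sq (c * x)) n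
          rw [← Real.exp_nat_mul] at h1
          simp only [mul_pow (2 : ℝ)]
          gcongr
          refine h1.trans (le_of_eq ?_)
          congr 1
          rw [mul_pow, hc2]
          field_simp
          ring
    _ ≤ _ := by
        rw [integral_const_mul, integral_exp_quadratic_gaussianReal (by norm_num)]
        gcongr
        simp only [ne_eq, OfNat.ofNat_ne_zero, not_false_eq_true, zero_pow, zero_div,
          Real.exp_zero, mul_one]
        rw [inv_le_comm₀ (by norm_num) (by norm_num)]
        apply Real.le_sqrt_of_sq_le
        norm_num

theorem mean_exp_sq_signs_le [Nonempty κ] :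
    ((Fintype.card (κ → Bool) : ℝ)⁻¹) ^ 2 * ∑ e : κ → Bool, ∑ e' : κ → Bool,
      Real.exp ((∑ k, sgn (e k) * sgn (e' k)) ^ 2 / (9 * Fintype.card κ)) ≤ 34 / 25 := by
  have hN : (Fintype.card (κ → Bool) : ℝ) = 2 ^ Fintype.card κ := by simp
  have h2 : (0 : ℝ) < 2 ^ Fintype.card κ := by positivity
  have h := Finset.sum_le_sum fun (e : κ → Bool) (_ : e ∈ Finset.univ) => sum_exp_sq_signs_le e
  rw [Finset.sum_const, Finset.card_univ, nsmul_eq_mul, hN] at h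
  rw [hN, inv_pow, inv_mul_le_iff₀ (by positivity)]
  refine h.trans (le_of_eq (by ring))

end Signs

/-! ### The two families of hypotheses -/

section Corner

/-- The block diagonal matrix with blocks `r` and `Z`. -/
noncomputable def corner (r : ℝ) (Z : Fin m → Fin n → ℝ) : Matrix (Fin (m + 1)) (Fin (n + 1)) ℝ :=
  Matrix.of (Fin.cons (Fin.cons r fun _ => 0) fun i => Fin.cons 0 (Z i))

theorem sum_corner_sq (r : ℝ) (Z : Fin m → Fin n → ℝ) :
    ∑ i, ∑ j, corner r Z i j ^ 2 = r ^ 2 + ∑ i, ∑ j, Z i j ^ 2 := by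
  simp [corner, Fin.sum_univ_succ]

theorem frob_corner (Z Z' : Fin m → Fin n → ℝ) :
    frob (corner 0 Z) (corner 0 Z') = ∑ i, ∑ j, Z i j * Z' i j := by
  simp [frob, corner, Fin.sum_univ_succ]

theorem corner_add (r : ℝ) (Z : Fin m → Fin n → ℝ) :
    corner r (fun _ _ => 0) + corner 0 Z = corner r Z := by
  ext i j
  refine Fin.cases ?_ (fun i => ?_) i <;> refine Fin.cases ?_ (fun j => ?_) j <;>
    simp [corner]

/-- By Cauchy–Schwarz the Frobenius norm of Z bounds its operator norm, so the block r dominates and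
the first basis vector attains the maximum. -/
theorem sv_zero_corner {r : ℝ} (hr : 0 ≤ r) {Z : Fin m → Fin n → ℝ}
    (hZ : ∑ i, ∑ j, Z i j ^ 2 ≤ r ^ 2) : sv (corner r Z) 0 = r := by
  refine sv_zero_eq _ hr (fun x => ?_) (Fin.cons 1 fun _ => 0) (by simp [Fin.sum_univ_succ]) ?_
  · simp only [Fin.sum_univ_succ, Matrix.mulVec, dotProduct, corner, Matrix.of_apply,
      Fin.cons_zero, Fin.cons_succ, zero_mul, Finset.sum_const_zero, add_zero, zero_add]
    have h : ∀ i, (∑ j, Z i j * x (Fin.succ j)) ^ 2 ≤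
        (∑ j, Z i j ^ 2) * ∑ j, x (Fin.succ j) ^ 2 :=
      fun i => Finset.sum_mul_sq_le_sq_mul_sq _ _ _
    have h2 := Finset.sum_le_sum fun i (_ : i ∈ Finset.univ) => h i
    rw [← Finset.sum_mul] at h2
    have h3 : 0 ≤ ∑ j : Fin n, x j.succ ^ 2 := by positivity
    nlinarith [mul_le_mul_of_nonneg_right hZ h3]
  · simp [Fin.sum_univ_succ, Matrix.mulVec, dotProduct, corner]

theorem effRank_corner {r : ℝ} (hr : 0 ≤ r) {Z : Fin m → Fin n → ℝ}
    (hZ : ∑ i, ∑ j, Z i j ^ 2 ≤ r ^ 2) :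
    effRank (corner r Z) = (r ^ 2 + ∑ i, ∑ j, Z i j ^ 2) / r ^ 2 := by
  rw [effRank_eq, sum_corner_sq, sv_zero_corner hr hZ]

end Corner

section Spike

variable {q d : ℕ}

/-- The matrix `r I + u s sᵀ`, for a sign vector `s`, followed by `d` zero rows. -/
noncomputable def spike (d : ℕ) (r u : ℝ) (e : Fin q → Bool) : Matrix (Fin (q + d)) (Fin q) ℝ :=
  Matrix.of (Fin.addCases (fun i j => (if i = j then r else 0) + u * (sgn (e i) * sgn (e j)))
    fun _ _ => 0)

theorem frob_spike (u : ℝ) (e e' : Fin q → Bool) :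
    frob (spike d 0 u e) (spike d 0 u e') = u ^ 2 * (∑ k, sgn (e k) * sgn (e' k)) ^ 2 := by
  simp only [frob, spike, Fin.sum_univ_add, Matrix.of_apply, Fin.addCases_left, Fin.addCases_right,
    ite_self, zero_add, mul_zero, Finset.sum_const_zero, add_zero]
  rw [sq (∑ k, _), Finset.sum_mul_sum, Finset.mul_sum]
  refine Finset.sum_congr rfl fun i _ => ?_
  rw [Finset.mul_sum]
  exact Finset.sum_congr rfl fun j _ => by ring

theorem spike_add (r u : ℝ) (e₀ e : Fin q → Bool) :
    spike d r 0 e₀ + spike d 0 u e = spike d r u e := by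
  ext i j
  refine Fin.addCases (fun i => ?_) (fun i => ?_) i <;> simp [spike]

theorem sum_spike_sq (r u : ℝ) (e : Fin q → Bool) :
    ∑ i, ∑ j, spike d r u e i j ^ 2 = q * r ^ 2 + 2 * r * (q * u) + (q * u) ^ 2 := by
  simp only [spike, Fin.sum_univ_add, Matrix.of_apply, Fin.addCases_left, Fin.addCases_right,
    ne_eq, OfNat.ofNat_ne_zero, not_false_eq_true, zero_pow, Finset.sum_const_zero, add_zero]
  have h : ∀ i j : Fin q, ((if i = j then r else 0) + u * (sgn (e i) * sgn (e j))) ^ 2 =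
      (if i = j then r ^ 2 + 2 * r * u else 0) + u ^ 2 := by
    intro i j
    have hs : (sgn (e i) * sgn (e j)) ^ 2 = 1 := by rw [mul_pow, sgn_sq, sgn_sq, one_mul]
    split_ifs with hij
    · subst hij
      rw [sgn_mul_self]; ring
    · rw [zero_add, zero_add, mul_pow, hs, mul_one]
  simp only [h, Finset.sum_add_distrib, Finset.sum_ite_eq, Finset.mem_univ, if_true,
    Finset.sum_const, Finset.card_univ, Fintype.card_fin, nsmul_eq_mul]
  ring

theorem sum_spike_mulVec_sq (r u : ℝ) (e : Fin q → Bool) (x : Fin q → ℝ) :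
    ∑ i, (spike d r u e *ᵥ x) i ^ 2 =
      r ^ 2 * ∑ j, x j ^ 2 + (2 * r * u + q * u ^ 2) * (∑ j, sgn (e j) * x j) ^ 2 := by
  simp only [spike, Fin.sum_univ_add, Matrix.mulVec, dotProduct, Matrix.of_apply,
    Fin.addCases_left, Fin.addCases_right, zero_mul, Finset.sum_const_zero, ne_eq,
    OfNat.ofNat_ne_zero, not_false_eq_true, zero_pow, add_zero]
  set y := ∑ j, sgn (e j) * x j with hy
  have h : ∀ i, (∑ j, ((if i = j then r else 0) + u * (sgn (e i) * sgn (e j))) * x j) ^ 2 =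
      r ^ 2 * x i ^ 2 + 2 * r * u * y * (sgn (e i) * x i) + u ^ 2 * y ^ 2 := by
    intro i
    have h1 : ∑ j, ((if i = j then r else 0) + u * (sgn (e i) * sgn (e j))) * x j =
        r * x i + u * sgn (e i) * y := by
      rw [hy, Finset.mul_sum]
      simp only [add_mul, ite_mul, zero_mul, Finset.sum_add_distrib, Finset.sum_ite_eq,
        Finset.mem_univ, if_true]
      congr 1
      exact Finset.sum_congr rfl fun j _ => by ring
    rw [h1]
    linear_combination u ^ 2 * y ^ 2 * sgn_sq (e i)
  simp only [h, Finset.sum_add_distrib, ← Finset.mul_sum, ← hy, Finset.sum_const,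
    Finset.card_univ, Fintype.card_fin, nsmul_eq_mul]
  ring

/-- Cauchy–Schwarz in `sum_spike_mulVec_sq`, with equality at the normalized sign vector, gives r² +
2rqu + q²u² = (r + qu)². -/
theorem sv_zero_spike (hq : 0 < q) {r u : ℝ} (hr : 0 ≤ r) (hu : 0 ≤ u) (e : Fin q → Bool) :
    sv (spike d r u e) 0 = r + q * u := by
  have hq0 : (0 : ℝ) < q := by exact_mod_cast hq
  have hs : √(q : ℝ) ^ 2 = q := Real.sq_sqrt hq0.le
  have hs0 : √(q : ℝ) ≠ 0 := (Real.sqrt_pos.2 hq0).ne'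
  have hx : ∑ j, (sgn (e j) / √(q : ℝ)) ^ 2 = 1 := by
    simp only [div_pow, sgn_sq, hs]
    simp [hq0.ne']
  refine sv_zero_eq _ (by positivity) (fun x => ?_) (fun j => sgn (e j) / √q) hx ?_
  · rw [sum_spike_mulVec_sq]
    have h := Finset.sum_mul_sq_le_sq_mul_sq Finset.univ (fun j => sgn (e j)) x
    simp only [sgn_sq, Finset.sum_const, Finset.card_univ, Fintype.card_fin, nsmul_eq_mul,
      mul_one] at h
    have h0 : 0 ≤ 2 * r * u + q * u ^ 2 := by positivity
    nlinarith [mul_le_mul_of_nonneg_left h h0]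
  · rw [sum_spike_mulVec_sq, hx]
    have h : ∑ j, sgn (e j) * (sgn (e j) / √(q : ℝ)) = √(q : ℝ) := by
      simp only [← mul_div_assoc, sgn_mul_self, Finset.sum_const, Finset.card_univ,
        Fintype.card_fin, nsmul_eq_mul]
      rw [mul_one, div_eq_iff hs0, ← sq, hs]
    rw [h, hs]
    ring

theorem effRank_spike (hq : 0 < q) {r u : ℝ} (hr : 0 ≤ r) (hu : 0 ≤ u) (e : Fin q → Bool) :
    effRank (spike d r u e) =
      (q * r ^ 2 + 2 * r * (q * u) + (q * u) ^ 2) / (r + q * u) ^ 2 := by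
  rw [effRank_eq, sum_spike_sq, sv_zero_spike hq hr hu]

end Spike

/-! ### The two lower bounds and their combination -/

theorem minimax_risk_ge_of_le_noise_rate {p q : ℕ} (hq : 2 ≤ q) (hqp : q ≤ p) {r η : ℝ}
    (hr : ((p : ℝ) * q) ^ ((1 : ℝ) / 4) ≤ r) (hη : η ≤ √((p : ℝ) * q) / r ^ 2 / 12)
    {R : Matrix (Fin p) (Fin q) ℝ → ℝ} (hR : Measurable R) :
    ENNReal.ofReal (1 / 5) ≤
      ⨆ (A : Matrix (Fin p) (Fin q) ℝ) (_ : r ≤ sv A 0),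
        obsLaw A {Y : Matrix (Fin p) (Fin q) ℝ | η ≤ |R Y - effRank A| / effRank A} := by
  obtain ⟨m, rfl⟩ : ∃ m, p = m + 1 := ⟨p - 1, by omega⟩
  obtain ⟨n, rfl⟩ : ∃ n, q = n + 1 := ⟨q - 1, by omega⟩
  have hm : (1 : ℝ) ≤ m := by exact_mod_cast (by omega : 1 ≤ m)
  have hn : (1 : ℝ) ≤ n := by exact_mod_cast (by omega : 1 ≤ n)
  set x : ℝ := ((m + 1 : ℕ) : ℝ) * ((n + 1 : ℕ) : ℝ) with hx
  have hx0 : 0 < x := by positivity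
  -- Dropping a row and a column loses at most a factor 4, because p, q ≥ 2.
  have hx4 : x ≤ 4 * (m * n) := by
    rw [hx]; push_cast; nlinarith
  set a := √x with ha
  have ha0 : 0 < a := Real.sqrt_pos.2 hx0
  have ha2 : a ^ 2 = x := Real.sq_sqrt hx0.le
  have hr0 : 0 < r := (Real.rpow_pos_of_pos hx0 _).trans_le hr
  have har : a ≤ r ^ 2 := by
    rw [ha, ← rpow_quarter_sq hx0.le]
    exact pow_le_pow_left₀ (by positivity) hr 2
  -- Chosen so that the sign block has squared Frobenius norm a/3, while mnτ⁴/2 = x/(18mn) ≤ 2/9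
  -- bounds the log second moment.
  set τ := √(a / (3 * (m * n))) with hτ
  have hτ2 : τ ^ 2 = a / (3 * (m * n)) := Real.sq_sqrt (by positivity)
  let Z : (Fin m × Fin n → Bool) → Fin m → Fin n → ℝ := fun e i j => τ * sgn (e (i, j))
  have hZ : ∀ e, ∑ i, ∑ j, Z e i j ^ 2 = a / 3 := by
    intro e
    simp only [Z, mul_pow, sgn_sq, hτ2, Finset.sum_const, Finset.card_univ, Fintype.card_fin,
      nsmul_eq_mul]
    field_simp
  have hfrob : ∀ e e', frob (corner 0 (Z e)) (corner 0 (Z e')) =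
      τ ^ 2 * ∑ k, sgn (e k) * sgn (e' k) := by
    intro e e'
    rw [frob_corner, Fintype.sum_prod_type, Finset.mul_sum]
    refine Finset.sum_congr rfl fun i _ => ?_
    rw [Finset.mul_sum]
    exact Finset.sum_congr rfl fun j _ => by simp only [Z]; ring
  have hle : ∀ e, ∑ i, ∑ j, Z e i j ^ 2 ≤ r ^ 2 := fun e => by rw [hZ]; linarith
  have hle0 : ∑ _i : Fin m, ∑ _j : Fin n, (0 : ℝ) ^ 2 ≤ r ^ 2 := by simp; positivity
  refine one_fifth_le_minimax_risk (corner r fun _ _ => 0) (fun e => corner 0 (Z e)) ?_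
    (e₀ := 1) (e₁ := 1 + a / r ^ 2 / 3) ?_ ?_ ?_ ?_ one_pos (by positivity) ?_ hR
  · simp only [hfrob]
    refine (mean_exp_signs_le (τ ^ 2)).trans ?_
    have h1 : (Fintype.card (Fin m × Fin n) : ℝ) * ((τ ^ 2) ^ 2 / 2) ≤ 2 / 9 := by
      rw [hτ2, div_pow, ha2]
      simp only [Fintype.card_prod, Fintype.card_fin, Nat.cast_mul]
      have : (m * n : ℝ) * (x / (3 * (m * n)) ^ 2 / 2) = x / (18 * (m * n)) := by
        field_simp; norm_num
      rw [this, div_le_iff₀ (by positivity)]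
      linarith
    refine (Real.exp_le_exp.2 h1).trans ?_
    -- This yields exp(2/9) ≤ 9/7 < 34/25.
    have h2 := Real.one_sub_le_exp_neg (2 / 9)
    rw [Real.exp_neg, le_inv_comm₀ (by norm_num) (Real.exp_pos _)] at h2
    exact h2.trans (by norm_num)
  · rw [sv_zero_corner hr0.le hle0]
  · intro e
    rw [corner_add, sv_zero_corner hr0.le (hle e)]
  · rw [effRank_corner hr0.le hle0]
    simp [hr0.ne']
  · intro e
    rw [corner_add, effRank_corner hr0.le (hle e), hZ]
    field_simp
  · have hs0 : 0 < a / r ^ 2 := by positivity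
    have hs1 : a / r ^ 2 ≤ 1 := (div_le_one (by positivity)).2 har
    rw [show (1 : ℝ) - (1 + a / r ^ 2 / 3) = -(a / r ^ 2 / 3) by ring, abs_neg,
      abs_of_pos (by positivity)]
    have h1 : 0 ≤ 1 + (1 + a / r ^ 2 / 3) := by positivity
    nlinarith [mul_le_mul_of_nonneg_right hη h1]

theorem minimax_risk_ge_of_le_linear_rate {p q : ℕ} (hq : 2 ≤ q) (hqp : q ≤ p) {r η : ℝ}
    (hr : ((p : ℝ) * q) ^ ((1 : ℝ) / 4) ≤ r) (hη : η ≤ √(q : ℝ) / r / 12)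
    {R : Matrix (Fin p) (Fin q) ℝ → ℝ} (hR : Measurable R) :
    ENNReal.ofReal (1 / 5) ≤
      ⨆ (A : Matrix (Fin p) (Fin q) ℝ) (_ : r ≤ sv A 0),
        obsLaw A {Y : Matrix (Fin p) (Fin q) ℝ | η ≤ |R Y - effRank A| / effRank A} := by
  have hbr : √(q : ℝ) ≤ r := (sqrt_le_rpow_quarter hqp).trans hr
  obtain ⟨d, rfl⟩ : ∃ d, p = q + d := ⟨p - q, by omega⟩
  have hq0 : 0 < q := by omega
  have hq2 : (2 : ℝ) ≤ q := by exact_mod_cast hq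
  set b := √(q : ℝ) with hb
  have hb0 : 0 < b := Real.sqrt_pos.2 (by linarith)
  have hb2 : b ^ 2 = q := Real.sq_sqrt (by linarith)
  have hr0 : 0 < r := hb0.trans_le hbr
  -- With qu = t = √q/3 one has u² = 1/(9q), exactly the normalization of `mean_exp_sq_signs_le`.
  set t := b / 3 with ht
  have ht0 : 0 < t := by positivity
  set u := t / q with hu
  have hqu : q * u = t := by rw [hu]; field_simp
  have hu0 : 0 < u := by positivity
  have hη' : η ≤ t / r / 4 := hη.trans (le_of_eq (by rw [ht]; ring))
  have : Nonempty (Fin q) := ⟨⟨0, hq0⟩⟩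
  have h0 : effRank (spike d r 0 fun _ : Fin q => true) = q := by
    rw [effRank_spike hq0 hr0.le le_rfl]
    simp [hr0.ne']
  refine one_fifth_le_minimax_risk (spike d r 0 fun _ => true)
    (fun e : Fin q → Bool => spike d 0 u e) ?_
    (e₀ := q) (e₁ := (q * r ^ 2 + 2 * r * t + t ^ 2) / (r + t) ^ 2) ?_ ?_ h0 ?_ (by linarith)
    (by positivity) ?_ hR
  · simp only [frob_spike]
    refine le_of_eq_of_le ?_ (mean_exp_sq_signs_le (κ := Fin q))
    congr 1
    refine Finset.sum_congr rfl fun e _ => Finset.sum_congr rfl fun e' _ => ?_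
    congr 1
    have hu2 : u ^ 2 = 1 / (9 * q) := by
      rw [hu, ht, div_pow, div_pow, hb2]
      field_simp
      norm_num
    rw [hu2, Fintype.card_fin]
    ring
  · rw [sv_zero_spike hq0 hr0.le le_rfl]; simp
  · intro e
    rw [spike_add, sv_zero_spike hq0 hr0.le hu0.le]
    linarith
  · intro e
    rw [spike_add, effRank_spike hq0 hr0.le hu0.le, hqu]
  · have htr : t ≤ r / 3 := by rw [ht]; linarith
    -- The gap is about (q - 1)·2t/r, and q - 1 ≥ q/2 makes it comparable to q·t/r; for q = 1 it
    -- would vanish.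
    have e1 : (q : ℝ) - (q * r ^ 2 + 2 * r * t + t ^ 2) / (r + t) ^ 2 =
        (q - 1) * (2 * r + t) * t / (r + t) ^ 2 := by
      field_simp; ring
    have e2 : 0 ≤ (q - 1) * (2 * r + t) * t / (r + t) ^ 2 := by
      have : (0 : ℝ) ≤ q - 1 := by linarith
      positivity
    rw [e1, abs_of_nonneg e2]
    have e3 : (q * r ^ 2 + 2 * r * t + t ^ 2) / (r + t) ^ 2 ≤ q := by linarith
    have e4 : (r + t) ^ 2 ≤ (2 * r + t) * r := by nlinarith
    calc η * (q + (q * r ^ 2 + 2 * r * t + t ^ 2) / (r + t) ^ 2)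
        ≤ t / r / 4 * (q + (q * r ^ 2 + 2 * r * t + t ^ 2) / (r + t) ^ 2) := by gcongr
      _ ≤ t / r / 4 * (q + q) := by gcongr
      _ = q / 2 * (t / r) := by ring
      _ ≤ (q - 1) * (t / r) := by gcongr; linarith
      _ ≤ _ := by
        rw [mul_div_assoc', div_le_div_iff₀ hr0 (by positivity)]
        have h1 : (0 : ℝ) ≤ (q - 1) * t := mul_nonneg (by linarith) ht0.le
        nlinarith [mul_le_mul_of_nonneg_left e4 h1]

theorem minimax_lower_bound :
    ∃ c > (0 : ℝ), ∀ p q : ℕ, 2 ≤ q → q ≤ p →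
      ∀ r : ℝ, ((p : ℝ) * q) ^ ((1 : ℝ) / 4) ≤ r →
        ENNReal.ofReal (1 / 5) ≤
          ⨅ (R : Matrix (Fin p) (Fin q) ℝ → ℝ) (_ : Measurable R),
            ⨆ (A : Matrix (Fin p) (Fin q) ℝ) (_ : r ≤ sv A 0),
              obsLaw A {Y : Matrix (Fin p) (Fin q) ℝ |
                c * (√((p : ℝ) * q) / r ^ 2 + √(q : ℝ) / r) ≤
                  |R Y - effRank A| / effRank A} := by
  -- The larger of the two terms is at least half their sum, and each construction allows the
  -- constant 1/12.
  refine ⟨1 / 24, by norm_num, fun p q hq hqp r hr => le_iInf₂ fun R hR => ?_⟩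
  rcases le_total (√(q : ℝ) / r) (√((p : ℝ) * q) / r ^ 2) with h | h
  · exact minimax_risk_ge_of_le_noise_rate hq hqp hr (by linarith) hR
  · exact minimax_risk_ge_of_le_linear_rate hq hqp hr (by linarith) hR

end EffRank

theorem mainTheorem12 :
    (∀ α : ℝ, 0 < α → α < 1 / 2 →
      ∃ c > (0 : ℝ), ∃ c' > (0 : ℝ), ∀ p q : ℕ, 2 ≤ q → q ≤ p →
        ∀ A : Matrix (Fin p) (Fin q) ℝ,
          c * ((p : ℝ) * q) ^ ((1 : ℝ) / 4) ≤ EffRank.sv A 0 →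
          ENNReal.ofReal (1 - α) ≤
            EffRank.obsLaw A {Y : Matrix (Fin p) (Fin q) ℝ |
              |EffRank.effRankEst Y - EffRank.effRank A| / EffRank.effRank A ≤
                c' * (√((p : ℝ) * q) / EffRank.sv A 0 ^ 2 + √(q : ℝ) / EffRank.sv A 0)}) ∧
    (∃ c > (0 : ℝ), ∀ p q : ℕ, 2 ≤ q → q ≤ p →
      ∀ r : ℝ, ((p : ℝ) * q) ^ ((1 : ℝ) / 4) ≤ r →
        ENNReal.ofReal (1 / 5) ≤
          ⨅ (R : Matrix (Fin p) (Fin q) ℝ → ℝ) (_ : Measurable R),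
            ⨆ (A : Matrix (Fin p) (Fin q) ℝ) (_ : r ≤ EffRank.sv A 0),
              EffRank.obsLaw A {Y : Matrix (Fin p) (Fin q) ℝ |
                c * (√((p : ℝ) * q) / r ^ 2 + √(q : ℝ) / r) ≤
                  |R Y - EffRank.effRank A| / EffRank.effRank A}) :=
  ⟨fun _ hα hα' => EffRank.effRankEst_upper_bound hα hα', EffRank.minimax_lower_bound⟩
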